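/- Let $S^2\subset\mathbb R^3$ be the unit sphere with round metric $\sigma_{AB}$, Levi-Civita connection $\nabla$, area measure, and coordinate functions $\tilde X^k$, $k=1,2,3$. A set of vacuum null infinity data on $\mathbb R\times S^2$ consists of a function $m$, a 1-form $N_A$ and a symmetric traceless 2-tensor $C_{AB}$ on $S^2$, depending smoothly on $(u,x)$, such that with the news $N_{AB}=\partial_uC_{AB}$ $$\partial_u m=-\tfrac18N_{AB}N^{AB}+\tfrac14\nabla^A\nabla^BN_{AB},$$ $$\partial_uN_A=\nabla_Am-\tfrac14\nabla^D(\nabla_D\nabla^EC_{EA}-\nabla_A\nabla^EC_{ED})+\tfrac14\nabla_A(C_{BE}N^{BE})-\tfrac14\nabla_B(C^{BD}N_{DA})+\tfrac12C_{AB}\nabla_DN^{DB}.$$ Put $E=\int_{S^2}2m$, $P^k=\int_{S^2}2m\tilde X^k$, and let the classical center of mass be $$\tilde C^k=\int_{S^2}\nabla^A\tilde X^k\Big[N_A-u\nabla_Am-\tfrac14C_A{}^D\nabla^BC_{DB}-\tfrac1{16}\nabla_A(C_{DE}C^{DE})\Big].$$ The total flux of a function $Q(u)$ is $Q(+)-Q(-)$,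 where $Q(\pm)=\lim_{u\to\pm\infty}Q(u)$. For a smooth function $f$ on $S^2$, the supertranslation $u=\bar u+f(x)$ leads to vacuum data $(\bar m,\bar N_A,\bar C_{AB})$ in the coordinates $(\bar u,x)$ with $$\bar m=m+\tfrac12\nabla^BN_{BD}\nabla^Df+\tfrac14\partial_uN_{BD}\nabla^Bf\nabla^Df+\tfrac14N_{BD}\nabla^B\nabla^Df,\qquad \bar C_{AB}=C_{AB}-2\nabla_A\nabla_Bf+\Delta f\,\sigma_{AB},$$ the right-hand sides being evaluated at $(\bar u+f(x),x)$ (and with $\bar N_A$ any solution of its evolution equation, which suffices to determine total fluxes); $\tilde C^k_f$ denotes their center of mass. The total flux of $\tilde C^k$ is called supertranslation invariant if, for every smooth $f=\alpha_0+\sum_i\alpha_i\tilde X^i+f_{\ell\ge2}$ with $f_{\ell\ge2}$ orthogonal to $1$ and to all $\tilde X^i$ in $L^2(S^2)$, and for $k=1,2,3$, $$\big(\tilde C^k_f(+)-\tilde C^k_f(-)\big)-\big(\tilde C^k(+)-\tilde C^k(-)\big)=\alpha_0\big(P^k(+)-P^k(-)\big)+\alpha_k\big(E(+)-E(-)\big);$$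 that is, it is invariant under the higher modes and equivariant under ordinary translations. **Theorem.** Let $(m,N_A,C_{AB})$ be vacuum null infinity data on $\mathbb R\times S^2$ and suppose that, for some $\varepsilon>0$, $N_{AB}(u,x)=O(|u|^{-1-\varepsilon})$ as $u\to\pm\infty$, uniformly in $x$ and together with its derivatives of order at most $2$ along $S^2$. Then the limits $m(\pm)(x)=\lim_{u\to\pm\infty}m(u,x)$, $\tilde C^k(\pm)$ and $\tilde C^k_f(\pm)$ exist, and the total flux of the classical center of mass is supertranslation invariant if and only if $m(+)-m(-)$ is a constant function on $S^2$. Moreover, writing $\delta m=m(+)-m(-)$, for every smooth $f$ and $k=1,2,3$ $$\big(\tilde C^k_f(+)-\tilde C^k_f(-)\big)-\big(\tilde C^k(+)-\tilde C^k(-)\big)=\int_{S^2}\big(2\tilde X^kf+2\nabla^A\tilde X^k\nabla_Af\big)\,\delta m,$$ and, if $\delta m$ is $C^1$, this equals $\int_{S^2}\big(6\tilde X^k\delta m-2\nabla^A\tilde X^k\nabla_A\delta m\big)f$. -/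

import Mathlib

open MeasureTheory Filter Topology
open scoped Manifold ContDiff

noncomputable section

namespace NullInfinity

/-! ### Tensor calculus on the unit sphere

Tensor fields on the unit sphere of `ℝ³` are given by their Cartesian components: a 1-form is a map
`S2 → Fin 3 → ℝ` annihilating the normal `x`, and likewise for 2-tensors. All indices are raised,
lowered and contracted with the induced round metric, which on tangential tensors is the Euclidean
contraction. The Levi-Civita derivative is the tangential projection of the flat derivative. -/

/-- The unit sphere in `ℝ³`. -/
abbrev S2 : Type := Metric.sphere (0 : EuclideanSpace ℝ (Fin 3)) 1

/-- The area measure of the standard round metric (total mass `4π`). -/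
abbrev area : Measure S2 := (volume : Measure (EuclideanSpace ℝ (Fin 3))).toSphere

/-- The restrictions `X̃^k` of the coordinate functions of `ℝ³`. -/
def X (k : Fin 3) (x : S2) : ℝ := x.1 k

/-- The extension of a function on the sphere to `ℝ³ ∖ {0}` that is constant along rays. -/
def radialExt (g : S2 → ℝ) (y : EuclideanSpace ℝ (Fin 3)) : ℝ :=
  if h : y = 0 then 0
  else g ⟨‖y‖⁻¹ • y, by simp [norm_smul, inv_mul_cancel₀ (norm_ne_zero_iff.mpr h)]⟩

/-- The `i`-th Cartesian component of the tangential gradient of a function on the sphere. (The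
radial derivative of the extension vanishes, so its gradient is tangential.) -/
def pd (i : Fin 3) (g : S2 → ℝ) (x : S2) : ℝ :=
  fderiv ℝ (radialExt g) x.1 (EuclideanSpace.single i 1)

/-- The round metric `σ` in Cartesian components, which is the projection to the tangent plane. -/
def σ (x : S2) (i j : Fin 3) : ℝ := (if i = j then 1 else 0) - x.1 i * x.1 j

/-- `∇_i g`. -/
def grad (g : S2 → ℝ) (x : S2) (i : Fin 3) : ℝ := pd i g x

/-- `∇_i w_j` for a 1-form `w`. -/
def covForm (w : S2 → Fin 3 → ℝ) (x : S2) (i j : Fin 3) : ℝ :=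
  ∑ l, σ x j l * pd i (fun y => w y l) x

/-- `∇_i T_{jk}` for a 2-tensor `T`. -/
def covTensor (T : S2 → Fin 3 → Fin 3 → ℝ) (x : S2) (i j k : Fin 3) : ℝ :=
  ∑ a, ∑ b, σ x j a * σ x k b * pd i (fun y => T y a b) x

/-- `∇^i w_i`. -/
def divForm (w : S2 → Fin 3 → ℝ) (x : S2) : ℝ := ∑ i, covForm w x i i

/-- `∇^i T_{ij}`. -/
def divTensor (T : S2 → Fin 3 → Fin 3 → ℝ) (x : S2) (j : Fin 3) : ℝ := ∑ i, covTensor T x i i j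

/-- `∇_i ∇_j g`. -/
def hess (g : S2 → ℝ) : S2 → Fin 3 → Fin 3 → ℝ := covForm (grad g)

/-- The Laplace-Beltrami operator `Δ`. -/
def lap (g : S2 → ℝ) (x : S2) : ℝ := divForm (grad g) x

/-- The pairing `S_{ij} T^{ij}`. -/
def pair (S T : Fin 3 → Fin 3 → ℝ) : ℝ := ∑ i, ∑ j, S i j * T i j

/-- Smooth functions on the sphere. -/
def SmoothOnS2 (g : S2 → ℝ) : Prop := ContMDiff (𝓡 2) 𝓘(ℝ, ℝ) ∞ g

/-- Smooth functions of `(u, x)` on `ℝ × S²`. -/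
def SmoothOnScri (g : ℝ → S2 → ℝ) : Prop :=
  ContMDiff (𝓘(ℝ, ℝ).prod (𝓡 2)) 𝓘(ℝ, ℝ) ∞ (fun p : ℝ × S2 => g p.1 p.2)

/-- `f` is supported in the modes `ℓ ≥ 2`: it is `L²`-orthogonal to the constants (`ℓ = 0`) and to
the coordinate functions (`ℓ = 1`). -/
def SupportedInHigherModes (f : S2 → ℝ) : Prop :=
  ∫ x, f x ∂area = 0 ∧ ∀ i, ∫ x, f x * X i x ∂area = 0

/-! ### Null infinity data -/

/-- Mass aspect `m`, angular momentum aspect `N_A` and shear `C_{AB}` on `ℝ × S²`, as functions of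
the retarded time `u` and the point `x`. -/
structure Data where
  m : ℝ → S2 → ℝ
  NA : ℝ → S2 → Fin 3 → ℝ
  C : ℝ → S2 → Fin 3 → Fin 3 → ℝ

namespace Data

variable (D : Data)

/-- The news tensor `N_{AB} = ∂_u C_{AB}`. -/
def news (u : ℝ) (x : S2) (i j : Fin 3) : ℝ := deriv (fun s => D.C s x i j) u

/-- The data consist of a smooth function, a smooth 1-form and a smooth symmetric traceless 2-tensor
on the sphere, depending smoothly on `u`, and satisfy the evolution equations of null infinity
implied by the vacuum Einstein equation:
`∂_u m = -⅛ N_{AB} N^{AB} + ¼ ∇^A ∇^B N_{AB}` and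
`∂_u N_A = ∇_A m - ¼ ∇^D (∇_D ∇^E C_{EA} - ∇_A ∇^E C_{ED}) + ¼ ∇_A (C_{BE} N^{BE})
  - ¼ ∇_B (C^{BD} N_{DA}) + ½ C_{AB} ∇_D N^{DB}`. -/
structure IsVacuum : Prop where
  smooth_m : SmoothOnScri D.m
  smooth_NA : ∀ i, SmoothOnScri fun u x => D.NA u x i
  smooth_C : ∀ i j, SmoothOnScri fun u x => D.C u x i j
  tangential_NA : ∀ u x, ∑ i, x.1 i * D.NA u x i = 0
  tangential_C : ∀ u x j, ∑ i, x.1 i * D.C u x i j = 0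
  symm_C : ∀ u x i j, D.C u x i j = D.C u x j i
  traceless_C : ∀ u x, ∑ i, D.C u x i i = 0
  evolution_m : ∀ u x, deriv (fun s => D.m s x) u =
    -(1 / 8) * pair (D.news u x) (D.news u x) + 1 / 4 * divForm (divTensor (D.news u)) x
  evolution_NA : ∀ u x i, deriv (fun s => D.NA s x i) u =
    grad (D.m u) x i
      - 1 / 4 * divTensor (fun y d a =>
          covForm (divTensor (D.C u)) y d a - covForm (divTensor (D.C u)) y a d) x i
      + 1 / 4 * grad (fun y => pair (D.C u y) (D.news u y)) x i
      - 1 / 4 * divTensor (fun y b a => ∑ d, D.C u y b d * D.news u y d a) x i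
      + 1 / 2 * ∑ b, D.C u x i b * divTensor (D.news u) x b

/-- The news is `O(|u|^{-1-ε})` as `u → ±∞` for some `ε > 0`, uniformly on the sphere and together
with its derivatives of order at most two along the sphere. (Bounds on iterated tangential
derivatives of the Cartesian components are equivalent to bounds on covariant derivatives.) -/
def NewsDecay : Prop :=
  ∃ ε K R : ℝ, 0 < ε ∧ ∀ u : ℝ, R ≤ |u| → 0 < |u| → ∀ (x : S2) (i j : Fin 3),
    |D.news u x i j| ≤ K * |u| ^ (-1 - ε) ∧
    (∀ a, |pd a (fun y => D.news u y i j) x| ≤ K * |u| ^ (-1 - ε)) ∧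
    (∀ a b, |pd a (pd b (fun y => D.news u y i j)) x| ≤ K * |u| ^ (-1 - ε))

/-- The energy `E = ∫ 2m`. -/
def energy (u : ℝ) : ℝ := ∫ x, 2 * D.m u x ∂area

/-- The linear momentum `P^k = ∫ 2m X̃^k`. -/
def momentum (k : Fin 3) (u : ℝ) : ℝ := ∫ x, 2 * D.m u x * X k x ∂area

/-- The classical center of mass
`C̃^k = ∫ ∇^A X̃^k [N_A - u ∇_A m - ¼ C_A^D ∇^B C_{DB} - (1/16) ∇_A (C_{DE} C^{DE})]`. -/
def centerOfMass (k : Fin 3) (u : ℝ) : ℝ :=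
  ∫ x, ∑ i, grad (X k) x i *
    (D.NA u x i - u * grad (D.m u) x i
      - 1 / 4 * ∑ d, D.C u x i d * divTensor (D.C u) x d
      - 1 / 16 * grad (fun y => pair (D.C u y) (D.C u y)) x i) ∂area

/-- `D'` is a set of vacuum data in the coordinates `(ū, x)` that are related to the coordinates
`(u, x)` of `D` by the supertranslation `u = ū + f(x)`:
`m̄(ū, x) = m + ½ (∇^B N_{BD}) ∇^D f + ¼ (∂_u N_{BD}) ∇^B f ∇^D f + ¼ N_{BD} ∇^B ∇^D f` and
`C̄_{AB}(ū, x) = C_{AB} - 2 ∇_A ∇_B f + Δf σ_{AB}`, the right-hand sides taken at `(ū + f(x), x)`.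
The angular momentum aspect of `D'` may be any solution of its evolution equation; any two of them
differ by a 1-form independent of `ū`, which does not affect total fluxes. -/
structure IsSupertranslate (f : S2 → ℝ) (D' : Data) : Prop where
  vacuum : D'.IsVacuum
  m_eq : ∀ u x, D'.m u x = D.m (u + f x) x
    + 1 / 2 * ∑ d, divTensor (D.news (u + f x)) x d * grad f x d
    + 1 / 4 * ∑ b, ∑ d,
        deriv (fun s => D.news s x b d) (u + f x) * grad f x b * grad f x d
    + 1 / 4 * pair (D.news (u + f x) x) (hess f x)
  C_eq : ∀ u x i j, D'.C u x i j = D.C (u + f x) x i j - 2 * hess f x i j + lap f x * σ x i j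

end Data

/-- `F` is the total flux `Q(+) - Q(-)` of the quantity `Q`; in particular both limits exist. -/
def HasTotalFlux (Q : ℝ → ℝ) (F : ℝ) : Prop :=
  ∃ a b : ℝ, Tendsto Q atTop (𝓝 a) ∧ Tendsto Q atBot (𝓝 b) ∧ F = a - b

/-- The total flux of the classical center of mass is supertranslation invariant: for a
supertranslation `f = α₀ + ∑ αᵢ X̃^i + f_{ℓ ≥ 2}`, it does not depend on `f_{ℓ ≥ 2}` and it
transforms under the translation `α₀ + ∑ αᵢ X̃^i` by
`α₀ (P^k(+) - P^k(-)) + α_k (E(+) - E(-))`. -/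
def Data.CenterOfMassFluxInvariant (D : Data) : Prop :=
  ∃ (F P : Fin 3 → ℝ) (E : ℝ),
    (∀ k, HasTotalFlux (D.centerOfMass k) (F k)) ∧
    (∀ k, HasTotalFlux (D.momentum k) (P k)) ∧
    HasTotalFlux D.energy E ∧
    ∀ (α₀ : ℝ) (α : Fin 3 → ℝ) (h : S2 → ℝ), SmoothOnS2 h → SupportedInHigherModes h →
      ∀ D' : Data, D.IsSupertranslate (fun x => α₀ + ∑ i, α i * X i x + h x) D' →
        ∀ k, HasTotalFlux (D'.centerOfMass k) (F k + α₀ * P k + α k * E)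

end NullInfinity

end

/-! The `u`-derivative of `C̃^k` is the integral of a flux density quadratic in the shear and the
news plus the `u`-derivative of a term quadratic in the shear. Under the supertranslation `f` the
flux density changes by a term linear in the news and by a multiple of
`(X̃^k f + ∇X̃^k · ∇f) N_{AB} N^{AB}`, and by the mass loss formula `N_{AB} N^{AB}` has the
primitive `-8 (m - ∇^A ∇^B C_{AB} / 4)`. The total flux of `C̃^k_f` is therefore the difference of
the limits of a potential at `u = ±∞`. At each end the terms bilinear in the shear and `f`
integrate to zero, so that `f` contributes only the pairing of `2 (X̃^k f + ∇X̃^k · ∇f)` with `δm`.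

Invariance under the higher modes says that `δm` is orthogonal to `X̃^k h + ∇X̃^k · ∇h` for all `h`
in these modes. This expression gives `3 g` when summed over `k` with `h = X̃^k g`, so splitting off
the lowest modes of `X̃^k g` yields, with `⟨·⟩` the average over the sphere,
`3 ∫ g δm = ∑_k ⟨X̃^k g⟩ ∫ X̃^k δm + 3 ⟨g⟩ ∫ δm`. Taking `g = X̃^j` gives `∫ X̃^j δm = 0`, and
then `∫ g δm = ⟨g⟩ ∫ δm` for all `g`, so that `δm` is constant. -/

noncomputable section

namespace NullInfinity

/-! ### Extensions constant along rays -/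

/-- The ambient Euclidean space of the sphere. -/
abbrev E3 : Type := EuclideanSpace ℝ (Fin 3)

instance : Fact (Module.finrank ℝ E3 = 2 + 1) := ⟨finrank_euclideanSpace_fin⟩

/-- The radial projection `y / ‖y‖` of `ℝ³ ∖ {0}` to the sphere. -/
def radialProj (y : E3) (hy : y ≠ 0) : S2 :=
  ⟨‖y‖⁻¹ • y, by simp [norm_smul, inv_mul_cancel₀ (norm_ne_zero_iff.mpr hy)]⟩

theorem S2.coe_ne_zero (x : S2) : x.1 ≠ 0 := ne_zero_of_mem_unit_sphere x

theorem S2.sum_coord_mul_self (x : S2) : ∑ i, x.1 i * x.1 i = 1 := by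
  have h := EuclideanSpace.real_norm_sq_eq x.1
  rw [norm_eq_of_mem_sphere, one_pow] at h
  simpa only [sq] using h.symm

theorem radialProj_coe (x : S2) : radialProj x.1 x.coe_ne_zero = x :=
  Subtype.ext (by simp [radialProj])

theorem radialExt_of_ne (g : S2 → ℝ) {y : E3} (hy : y ≠ 0) :
    radialExt g y = g (radialProj y hy) :=
  dif_neg hy

theorem radialExt_zero (g : S2 → ℝ) : radialExt g 0 = 0 := dif_pos rfl

theorem radialExt_coe (g : S2 → ℝ) (x : S2) : radialExt g x.1 = g x := by
  rw [radialExt_of_ne g x.coe_ne_zero, radialProj_coe]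

theorem radialExt_smul (g : S2 → ℝ) {r : ℝ} (hr : 0 < r) (y : E3) :
    radialExt g (r • y) = radialExt g y := by
  rcases eq_or_ne y 0 with rfl | hy
  · rw [smul_zero]
  · rw [radialExt_of_ne g (smul_ne_zero hr.ne' hy), radialExt_of_ne g hy]
    congr 1
    refine Subtype.ext ?_
    simp only [radialProj, norm_smul, Real.norm_of_nonneg hr.le, smul_smul]
    congr 1
    field_simp

/-- The extension of a function on `ℝ × S²` to `ℝ × (ℝ³ ∖ {0})` that is constant along rays. -/
def scriExt (g : ℝ → S2 → ℝ) (p : ℝ × E3) : ℝ := radialExt (g p.1) p.2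

/-- The open set `ℝ × (ℝ³ ∖ {0})`, on which extensions constant along rays are smooth. -/
def punctured : TopologicalSpace.Opens (ℝ × E3) :=
  ⟨{p | p.2 ≠ 0}, isOpen_ne.preimage continuous_snd⟩

theorem punctured_mem_nhds (u : ℝ) {y : E3} (hy : y ≠ 0) :
    (punctured : Set (ℝ × E3)) ∈ 𝓝 (u, y) :=
  punctured.isOpen.mem_nhds hy

theorem contMDiff_radialProj {n : WithTop ℕ∞} :
    ContMDiff 𝓘(ℝ, ℝ × E3) (𝓡 2) n fun p : punctured => radialProj p.1.2 p.2 := by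
  have hunit (p : punctured) : ‖p.1.2‖⁻¹ • p.1.2 ∈ Metric.sphere (0 : E3) 1 :=
    (radialProj p.1.2 p.2).2
  refine ContMDiff.codRestrict_sphere (f := fun p : punctured => ‖p.1.2‖⁻¹ • p.1.2)
    (fun p => ?_) hunit
  refine (contMDiffAt_subtype_iff (f := fun p : ℝ × E3 => ‖p.2‖⁻¹ • p.2)).2
    (ContDiffAt.contMDiffAt ?_)
  exact ((contDiff_snd.contDiffAt.norm ℝ p.2).inv (norm_ne_zero_iff.2 p.2)).smul
    contDiff_snd.contDiffAt

theorem contDiffAt_scriExt {n : WithTop ℕ∞} {g : ℝ → S2 → ℝ}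
    (hg : ContMDiff (𝓘(ℝ, ℝ).prod (𝓡 2)) 𝓘(ℝ, ℝ) n fun p : ℝ × S2 => g p.1 p.2)
    (u : ℝ) {y : E3} (hy : y ≠ 0) : ContDiffAt ℝ n (scriExt g) (u, y) := by
  have hproj : ContMDiff 𝓘(ℝ, ℝ × E3) (𝓘(ℝ, ℝ).prod (𝓡 2)) n
      fun p : punctured => (p.1.1, radialProj p.1.2 p.2) := by
    refine ContMDiff.prodMk (fun p => ?_) contMDiff_radialProj
    exact (contMDiffAt_subtype_iff (f := fun p : ℝ × E3 => p.1)).2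
      contDiff_fst.contMDiff.contMDiffAt
  have hcomp := (hg.comp hproj).congr fun p : punctured => radialExt_of_ne (g p.1.1) p.2
  exact (contMDiffAt_subtype_iff (x := (⟨(u, y), hy⟩ : punctured)).1
    hcomp.contMDiffAt).contDiffAt

theorem contDiffAt_radialExt {n : WithTop ℕ∞} {g : S2 → ℝ} (hg : ContMDiff (𝓡 2) 𝓘(ℝ, ℝ) n g)
    {y : E3} (hy : y ≠ 0) : ContDiffAt ℝ n (radialExt g) y :=
  (contDiffAt_scriExt (g := fun _ => g) (hg.comp contMDiff_snd) 0 hy).comp y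
    (contDiff_prodMk_right 0).contDiffAt

/-! ### Smooth functions -/

/-- Continuously differentiable functions on the sphere. -/
abbrev C1 (g : S2 → ℝ) : Prop := ContMDiff (𝓡 2) 𝓘(ℝ, ℝ) 1 g

theorem C1.differentiableAt {g : S2 → ℝ} (hg : C1 g) {y : E3} (hy : y ≠ 0) :
    DifferentiableAt ℝ (radialExt g) y :=
  (contDiffAt_radialExt (n := 1) hg hy).differentiableAt one_ne_zero

theorem C1.continuousOn_fderiv {g : S2 → ℝ} (hg : C1 g) (v : E3) :
    ContinuousOn (fun y => fderiv ℝ (radialExt g) y v) {y | y ≠ 0} :=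
  (ContDiffOn.continuousOn_fderiv_of_isOpen
    (fun _ hy => (contDiffAt_radialExt (n := 1) hg hy).contDiffWithinAt) isOpen_ne
    le_rfl).clm_apply continuousOn_const

theorem C1.continuous_pd {g : S2 → ℝ} (hg : C1 g) (i : Fin 3) : Continuous (pd i g) :=
  (hg.continuousOn_fderiv _).comp_continuous continuous_subtype_val S2.coe_ne_zero

theorem SmoothOnS2.c1 {g : S2 → ℝ} (hg : SmoothOnS2 g) : C1 g := hg.of_le (by norm_cast)

theorem SmoothOnS2.const (c : ℝ) : SmoothOnS2 fun _ => c := contMDiff_const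

theorem smoothOnS2_coord (k : Fin 3) : SmoothOnS2 fun x => x.1 k :=
  (EuclideanSpace.proj (𝕜 := ℝ) k : E3 →L[ℝ] ℝ).contDiff.contMDiff.comp contMDiff_coe_sphere

theorem SmoothOnS2.smoothOnScri {g : S2 → ℝ} (hg : SmoothOnS2 g) : SmoothOnScri fun _ => g :=
  ContMDiff.comp hg contMDiff_snd

section SmoothOnScri

variable {g h : ℝ → S2 → ℝ}

theorem SmoothOnScri.slice (hg : SmoothOnScri g) (u : ℝ) : SmoothOnS2 (g u) :=
  ContMDiff.comp (g := fun p : ℝ × S2 => g p.1 p.2) hg (contMDiff_const.prodMk contMDiff_id)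

theorem SmoothOnScri.continuous (hg : SmoothOnScri g) : Continuous fun p : ℝ × S2 => g p.1 p.2 :=
  ContMDiff.continuous hg

theorem SmoothOnScri.add (hg : SmoothOnScri g) (hh : SmoothOnScri h) :
    SmoothOnScri fun u x => g u x + h u x := ContMDiff.add hg hh

theorem SmoothOnScri.sub (hg : SmoothOnScri g) (hh : SmoothOnScri h) :
    SmoothOnScri fun u x => g u x - h u x := ContMDiff.sub hg hh

theorem SmoothOnScri.mul (hg : SmoothOnScri g) (hh : SmoothOnScri h) :
    SmoothOnScri fun u x => g u x * h u x := ContMDiff.mul hg hh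

theorem SmoothOnScri.const (c : ℝ) : SmoothOnScri fun _ _ => c := contMDiff_const

theorem SmoothOnScri.sum {ι : Type*} {s : Finset ι} {g : ι → ℝ → S2 → ℝ}
    (hg : ∀ i ∈ s, SmoothOnScri (g i)) : SmoothOnScri fun u x => ∑ i ∈ s, g i u x :=
  contMDiff_finsetSum hg

theorem SmoothOnScri.shift {f : S2 → ℝ} (hg : SmoothOnScri g) (hf : SmoothOnS2 f) :
    SmoothOnScri fun u x => g (u + f x) x :=
  ContMDiff.comp hg ((contMDiff_fst.add (ContMDiff.comp hf contMDiff_snd)).prodMk contMDiff_snd)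

theorem SmoothOnScri.of_contDiffOn {F : ℝ × E3 → ℝ} (hF : ContDiffOn ℝ ∞ F punctured) :
    SmoothOnScri fun u x => F (u, x.1) :=
  hF.contMDiffOn.comp_contMDiff
    (ContMDiff.prodMk_space contMDiff_fst (contMDiff_coe_sphere.comp contMDiff_snd))
    fun p => p.2.coe_ne_zero

theorem SmoothOnScri.contDiffOn_fderiv (hg : SmoothOnScri g) :
    ContDiffOn ℝ ∞ (fderiv ℝ (scriExt g)) punctured :=
  ContDiffOn.fderiv_of_isOpen (fun p hp => (contDiffAt_scriExt hg p.1 hp).contDiffWithinAt)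
    punctured.isOpen (by norm_num)

theorem SmoothOnScri.hasFDerivAt (hg : SmoothOnScri g) (u : ℝ) {y : E3} (hy : y ≠ 0) :
    HasFDerivAt (scriExt g) (fderiv ℝ (scriExt g) (u, y)) (u, y) :=
  ((contDiffAt_scriExt hg u hy).differentiableAt (by norm_num)).hasFDerivAt

theorem SmoothOnScri.hasFDerivAt_fderiv (hg : SmoothOnScri g) (u : ℝ) {y : E3} (hy : y ≠ 0) :
    HasFDerivAt (fderiv ℝ (scriExt g)) (fderiv ℝ (fderiv ℝ (scriExt g)) (u, y)) (u, y) :=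
  ((hg.contDiffOn_fderiv.contDiffAt (punctured_mem_nhds u hy)).differentiableAt
    (by norm_num)).hasFDerivAt

/-! ### Derivatives on `ℝ × S²` -/

theorem SmoothOnScri.hasDerivAt_radialExt (hg : SmoothOnScri g) (u : ℝ) {y : E3} (hy : y ≠ 0) :
    HasDerivAt (fun s => radialExt (g s) y) (fderiv ℝ (scriExt g) (u, y) (1, 0)) u :=
  (hg.hasFDerivAt u hy).comp_hasDerivAt (f := fun s => (s, y)) u
    ((hasDerivAt_id u).prodMk (hasDerivAt_const u y))

theorem SmoothOnScri.deriv_eq_fderiv (hg : SmoothOnScri g) (u : ℝ) (x : S2) :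
    deriv (fun s => g s x) u = fderiv ℝ (scriExt g) (u, x.1) (1, 0) := by
  simpa only [radialExt_coe] using (hg.hasDerivAt_radialExt u x.coe_ne_zero).deriv

theorem SmoothOnScri.hasDerivAt (hg : SmoothOnScri g) (u : ℝ) (x : S2) :
    HasDerivAt (fun s => g s x) (deriv (fun s => g s x) u) u := by
  simpa only [radialExt_coe, hg.deriv_eq_fderiv] using hg.hasDerivAt_radialExt u x.coe_ne_zero

theorem SmoothOnScri.pd_eq_fderiv (hg : SmoothOnScri g) (i : Fin 3) (u : ℝ) (x : S2) :
    pd i (g u) x = fderiv ℝ (scriExt g) (u, x.1) (0, EuclideanSpace.single i 1) := by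
  have h := (hg.hasFDerivAt u x.coe_ne_zero).comp x.1 (hasFDerivAt_prodMk_right u x.1)
  exact congrArg (· (EuclideanSpace.single i 1)) h.fderiv

theorem SmoothOnScri.pd (hg : SmoothOnScri g) (i : Fin 3) :
    SmoothOnScri fun u => pd i (g u) := by
  simp only [SmoothOnScri, hg.pd_eq_fderiv i]
  exact SmoothOnScri.of_contDiffOn (hg.contDiffOn_fderiv.clm_apply contDiffOn_const)

theorem SmoothOnScri.deriv (hg : SmoothOnScri g) :
    SmoothOnScri fun u x => deriv (fun s => g s x) u := by
  simp only [SmoothOnScri, hg.deriv_eq_fderiv]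
  exact SmoothOnScri.of_contDiffOn (hg.contDiffOn_fderiv.clm_apply contDiffOn_const)

theorem SmoothOnS2.pd {g : S2 → ℝ} (hg : SmoothOnS2 g) (i : Fin 3) : SmoothOnS2 (pd i g) :=
  (hg.smoothOnScri.pd i).slice 0

theorem SmoothOnScri.hasDerivAt_pd (hg : SmoothOnScri g) (i : Fin 3) (u : ℝ) (x : S2) :
    HasDerivAt (fun s => NullInfinity.pd i (g s) x)
      (NullInfinity.pd i (fun y => _root_.deriv (fun s => g s y) u) x) u := by
  have hx := x.coe_ne_zero
  have hD := hg.hasFDerivAt_fderiv u hx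
  have hsymm := (contDiffAt_scriExt hg u hx).isSymmSndFDerivAt (by simp; norm_cast)
  let e : E3 := EuclideanSpace.single i 1
  have hu : HasDerivAt (fun s => fderiv ℝ (scriExt g) (s, x.1) (0, e))
      (fderiv ℝ (fderiv ℝ (scriExt g)) (u, x.1) (1, 0) (0, e)) u :=
    by simpa using (hD.comp_hasDerivAt (f := fun s => (s, x.1)) u
      ((hasDerivAt_id u).prodMk (hasDerivAt_const u x.1))).clm_apply
        (hasDerivAt_const u ((0 : ℝ), e))
  have hy : HasFDerivAt (fun y => fderiv ℝ (scriExt g) (u, y) (1, 0)) _ x.1 :=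
    (hD.comp x.1 (hasFDerivAt_prodMk_right u x.1)).clm_apply (hasFDerivAt_const _ _)
  have hext : radialExt (fun y => _root_.deriv (fun s => g s y) u)
      =ᶠ[𝓝 x.1] fun y => fderiv ℝ (scriExt g) (u, y) (1, 0) := by
    filter_upwards [isOpen_ne.mem_nhds hx] with y hy
    rw [radialExt_of_ne _ hy, ← (hg.hasDerivAt_radialExt u hy).deriv]
    simp only [radialExt_of_ne _ hy]
  have hpd : NullInfinity.pd i (fun y => _root_.deriv (fun s => g s y) u) x
      = fderiv ℝ (fderiv ℝ (scriExt g)) (u, x.1) (1, 0) (0, e) := by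
    rw [NullInfinity.pd, hext.fderiv_eq, hy.fderiv, hsymm.eq]
    simp [e]
  simpa only [hpd, hg.pd_eq_fderiv] using hu

theorem SmoothOnScri.pd_shift (hg : SmoothOnScri g) {f : S2 → ℝ} (hf : C1 f) (i : Fin 3)
    (u : ℝ) (x : S2) :
    NullInfinity.pd i (fun y => g (u + f y) y) x
      = NullInfinity.pd i (g (u + f x)) x
        + _root_.deriv (fun s => g s x) (u + f x) * NullInfinity.pd i f x := by
  have hx := x.coe_ne_zero
  let e : E3 := EuclideanSpace.single i 1
  have hext : radialExt (fun y => g (u + f y) y)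
      =ᶠ[𝓝 x.1] fun y => scriExt g (u + radialExt f y, y) := by
    filter_upwards [isOpen_ne.mem_nhds hx] with y hy
    simp only [scriExt, radialExt_of_ne _ hy]
  have hchain : HasFDerivAt (fun y => scriExt g (u + radialExt f y, y)) _ x.1 :=
    HasFDerivAt.comp x.1 (g := scriExt g) (f := fun y => (u + radialExt f y, y))
      (by rw [radialExt_coe]; exact hg.hasFDerivAt _ hx)
      (((hf.differentiableAt hx).hasFDerivAt.const_add u).prodMk (hasFDerivAt_id x.1))
  have hsplit : (fderiv ℝ (radialExt f) x.1 e, e)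
      = ((0 : ℝ), e) + fderiv ℝ (radialExt f) x.1 e • ((1 : ℝ), (0 : E3)) := by simp
  rw [NullInfinity.pd, hext.fderiv_eq, hchain.fderiv, hg.pd_eq_fderiv, hg.deriv_eq_fderiv]
  change fderiv ℝ (scriExt g) (u + f x, x.1) (fderiv ℝ (radialExt f) x.1 e, e) = _
  rw [hsplit, map_add, map_smul, smul_eq_mul, mul_comm]
  rfl

end SmoothOnScri

/-! ### The tangential gradient -/

section Gradient

variable {g h : S2 → ℝ}

theorem hasFDerivAt_norm {y : E3} (hy : y ≠ 0) :
    HasFDerivAt (fun z : E3 => ‖z‖) (‖y‖⁻¹ • innerSL ℝ y) y := by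
  have h := (hasStrictFDerivAt_norm_sq y).hasFDerivAt.sqrt (by simpa using hy)
  simp only [Real.sqrt_sq (norm_nonneg _)] at h
  refine h.congr_fderiv ?_
  rw [← Nat.cast_smul_eq_nsmul ℝ, smul_smul]
  congr 1
  push_cast
  field_simp

theorem radialExt_comp₂ (F : ℝ → ℝ → ℝ) {x : S2} :
    radialExt (fun y => F (g y) (h y)) =ᶠ[𝓝 x.1] fun y => F (radialExt g y) (radialExt h y) := by
  filter_upwards [isOpen_ne.mem_nhds x.coe_ne_zero] with y hy
  simp only [radialExt_of_ne _ hy]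

theorem pd_const (i : Fin 3) (c : ℝ) (x : S2) : pd i (fun _ => c) x = 0 := by
  rw [pd, (radialExt_comp₂ (g := fun _ => 0) (h := fun _ => 0) fun _ _ => c).fderiv_eq]
  simp

theorem pd_add (i : Fin 3) (hg : C1 g) (hh : C1 h) (x : S2) :
    pd i (fun y => g y + h y) x = pd i g x + pd i h x := by
  rw [pd, (radialExt_comp₂ (· + ·)).fderiv_eq, fderiv_fun_add (hg.differentiableAt x.coe_ne_zero)
    (hh.differentiableAt x.coe_ne_zero)]
  rfl

theorem pd_mul (i : Fin 3) (hg : C1 g) (hh : C1 h) (x : S2) :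
    pd i (fun y => g y * h y) x = pd i g x * h x + g x * pd i h x := by
  rw [pd, (radialExt_comp₂ (· * ·)).fderiv_eq, fderiv_fun_mul (hg.differentiableAt x.coe_ne_zero)
    (hh.differentiableAt x.coe_ne_zero), radialExt_coe, radialExt_coe, add_comm,
    mul_comm (pd i g x)]
  rfl

theorem pd_const_mul (i : Fin 3) (c : ℝ) (hg : C1 g) (x : S2) :
    pd i (fun y => c * g y) x = c * pd i g x := by
  rw [pd_mul i contMDiff_const hg, pd_const, zero_mul, zero_add]

theorem pd_sub (i : Fin 3) (hg : C1 g) (hh : C1 h) (x : S2) :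
    pd i (fun y => g y - h y) x = pd i g x - pd i h x := by
  rw [pd, (radialExt_comp₂ (· - ·)).fderiv_eq, fderiv_fun_sub (hg.differentiableAt x.coe_ne_zero)
    (hh.differentiableAt x.coe_ne_zero)]
  rfl

theorem pd_sum {ι : Type*} (s : Finset ι) (i : Fin 3) {g : ι → S2 → ℝ} (hg : ∀ a ∈ s, C1 (g a))
    (x : S2) : pd i (fun y => ∑ a ∈ s, g a y) x = ∑ a ∈ s, pd i (g a) x := by
  have hext : radialExt (fun y => ∑ a ∈ s, g a y)
      =ᶠ[𝓝 x.1] fun y => ∑ a ∈ s, radialExt (g a) y := by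
    filter_upwards [isOpen_ne.mem_nhds x.coe_ne_zero] with y hy
    simp only [radialExt_of_ne _ hy]
  rw [pd, hext.fderiv_eq,
    fderiv_fun_sum fun a ha => (hg a ha).differentiableAt x.coe_ne_zero, sum_apply]
  rfl

theorem sum_coord_mul_pd (hg : C1 g) (x : S2) : ∑ i, x.1 i * pd i g x = 0 := by
  have hsum : ∑ i, x.1 i * pd i g x = fderiv ℝ (radialExt g) x.1 x.1 := by
    have h := congrArg (fderiv ℝ (radialExt g) x.1)
      ((EuclideanSpace.basisFun (Fin 3) ℝ).sum_repr x.1)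
    rw [map_sum] at h
    simpa [pd] using h
  have hline := (hg.differentiableAt x.coe_ne_zero).hasFDerivAt.hasLineDerivAt x.1
  have hray : (fun t : ℝ => radialExt g (x.1 + t • x.1)) =ᶠ[𝓝 0] fun _ => g x := by
    filter_upwards [Ioi_mem_nhds neg_one_lt_zero] with t ht
    have hline : x.1 + t • x.1 = (1 + t) • x.1 := by module
    rw [hline, radialExt_smul g (neg_lt_iff_pos_add'.1 ht), radialExt_coe]
  rw [hsum]
  exact HasDerivAt.unique hline ((hasDerivAt_const _ _).congr_of_eventuallyEq hray)

theorem pd_coord (i j : Fin 3) (x : S2) : pd i (fun y => y.1 j) x = σ x i j := by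
  have hext : radialExt (fun y => y.1 j) =ᶠ[𝓝 x.1] fun y => ‖y‖⁻¹ * y j := by
    filter_upwards [isOpen_ne.mem_nhds x.coe_ne_zero] with y hy
    rw [radialExt_of_ne _ hy]
    rfl
  have hinv := (hasDerivAt_inv (norm_ne_zero_iff.2 x.coe_ne_zero)).comp_hasFDerivAt x.1
    (hasFDerivAt_norm x.coe_ne_zero)
  have hcoord := (EuclideanSpace.proj (𝕜 := ℝ) j : E3 →L[ℝ] ℝ).hasFDerivAt (x := x.1)
  have hprod : HasFDerivAt (fun y : E3 => ‖y‖⁻¹ * y j) _ x.1 := hinv.mul hcoord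
  rw [pd, hext.fderiv_eq, hprod.fderiv]
  simp [σ, EuclideanSpace.inner_single_right, eq_comm, mul_comm (x.1 j), sub_eq_add_neg]

theorem radialExt_pd (i : Fin 3) (g : S2 → ℝ) {y : E3} (hy : y ≠ 0) :
    radialExt (pd i g) y = ‖y‖ * fderiv ℝ (radialExt g) y (EuclideanSpace.single i 1) := by
  have hr : 0 < ‖y‖ := norm_pos_iff.2 hy
  have hscale : (fun z => radialExt g (‖y‖ • z)) = radialExt g :=
    funext fun z => radialExt_smul g hr z
  have hpoint : ‖y‖ • (radialProj y hy).1 = y := by simp [radialProj, smul_smul, hr.ne']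
  rw [radialExt_of_ne _ hy, pd, ← hscale, fderiv_comp_smul, hpoint, hscale]
  rfl

theorem pd_pd (hg : SmoothOnS2 g) (i j : Fin 3) (x : S2) :
    pd j (pd i g) x = x.1 j * pd i g x
      + fderiv ℝ (fderiv ℝ (radialExt g)) x.1 (EuclideanSpace.single j 1)
          (EuclideanSpace.single i 1) := by
  have hext : radialExt (pd i g) =ᶠ[𝓝 x.1]
      fun y => ‖y‖ * fderiv ℝ (radialExt g) y (EuclideanSpace.single i 1) := by
    filter_upwards [isOpen_ne.mem_nhds x.coe_ne_zero] with y hy using radialExt_pd i g hy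
  have hdiff : DifferentiableAt ℝ (fderiv ℝ (radialExt g)) x.1 :=
    ((contDiffAt_radialExt hg x.coe_ne_zero).fderiv_right (m := 1)
      (by norm_cast)).differentiableAt one_ne_zero
  have hprod := (hasFDerivAt_norm x.coe_ne_zero).fun_mul
    (hdiff.hasFDerivAt.clm_apply (hasFDerivAt_const (EuclideanSpace.single i (1 : ℝ)) x.1))
  rw [pd, hext.fderiv_eq, hprod.fderiv]
  simp [EuclideanSpace.inner_single_right, pd]
  ring

theorem pd_comm (hg : SmoothOnS2 g) (i j : Fin 3) (x : S2) :
    pd j (pd i g) x - pd i (pd j g) x = x.1 j * pd i g x - x.1 i * pd j g x := by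
  have hsymm := (contDiffAt_radialExt hg x.coe_ne_zero).isSymmSndFDerivAt (by simp; norm_cast)
  rw [pd_pd hg, pd_pd hg, hsymm.eq, add_sub_add_right_eq_sub]

end Gradient

/-! ### The divergence theorem -/

theorem integrable_of_continuous {g : S2 → ℝ} (hg : Continuous g) : Integrable g area :=
  hg.integrable_of_hasCompactSupport (HasCompactSupport.of_compactSpace g)

theorem integral_norm_mul_radialExt (w : ℝ → ℝ) (k : S2 → ℝ) :
    ∫ y : E3, w ‖y‖ * radialExt k y
      = (∫ r in Set.Ioi (0 : ℝ), r ^ 2 * w r) * ∫ x, k x ∂area := by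
  calc ∫ y : E3, w ‖y‖ * radialExt k y
      = ∫ y : ({(0)}ᶜ : Set E3), w ‖y.1‖ * radialExt k y.1 ∂((volume : Measure E3).comap (↑)) := by
        rw [integral_subtype_comap (measurableSet_singleton _).compl
          fun y => w ‖y‖ * radialExt k y, restrict_compl_singleton]
    _ = ∫ p : S2 × Set.Ioi (0 : ℝ), k p.1 * w p.2 ∂area.prod (.volumeIoiPow 2) := by
        rw [show 2 = Module.finrank ℝ E3 - 1 by simp,
          ← (volume : Measure E3).measurePreserving_homeomorphUnitSphereProd.integral_comp
            (Homeomorph.measurableEmbedding _)]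
        refine integral_congr_ae (ae_of_all _ fun y => ?_)
        simp only [homeomorphUnitSphereProd_apply_snd_coe, radialExt_of_ne k y.2]
        rw [mul_comm]
        congr 2
        exact Subtype.ext (homeomorphUnitSphereProd_apply_fst_coe E3 y).symm
    _ = (∫ r : Set.Ioi (0 : ℝ), w r ∂Measure.volumeIoiPow 2) * ∫ x, k x ∂area := by
        rw [integral_prod_mul k fun r : Set.Ioi (0 : ℝ) => w r, mul_comm]
    _ = _ := by
        simp only [Measure.volumeIoiPow, ENNReal.ofReal]
        rw [integral_withDensity_eq_integral_smul
            (measurable_subtype_coe.pow_const _).real_toNNReal,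
          integral_subtype_comap measurableSet_Ioi fun r => Real.toNNReal (r ^ 2) • w r]
        simp only [NNReal.smul_def, Real.coe_toNNReal _ (sq_nonneg _), smul_eq_mul]

theorem integral_mul_fderiv_radialExt {Φ : E3 → ℝ} (hΦ : ContDiff ℝ 1 Φ)
    (hc : HasCompactSupport Φ) (h0 : 0 ∉ tsupport Φ) {g : S2 → ℝ} (hg : C1 g) (v : E3) :
    ∫ y, Φ y * fderiv ℝ (radialExt g) y v = -∫ y, fderiv ℝ Φ y v * radialExt g y := by
  have hne : ∀ y ∈ tsupport Φ, y ≠ 0 := fun y hy h => h0 (h ▸ hy)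
  have hext : ContinuousOn (radialExt g) {y | y ≠ 0} := fun y hy =>
    (hg.differentiableAt hy).continuousAt.continuousWithinAt
  have hint : ∀ Ψ q : E3 → ℝ, Continuous Ψ → tsupport Ψ ⊆ tsupport Φ →
      ContinuousOn q {y | y ≠ 0} → Integrable fun y => Ψ y * q y := by
    intro Ψ q hΨ hsub hq
    have hΨc : HasCompactSupport Ψ := hc.of_isClosed_subset (isClosed_tsupport _) hsub
    refine Continuous.integrable_of_hasCompactSupport ?_ hΨc.mul_right
    refine continuous_of_tsupport fun y hy => ?_
    have hy0 := hne y (hsub (tsupport_mul_subset_left hy))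
    exact hΨ.continuousAt.mul (hq.continuousAt (isOpen_ne.mem_nhds hy0))
  refine integral_mul_fderiv_eq_neg_fderiv_mul_of_integrable
    (hint _ _ ?_ (tsupport_fderiv_apply_subset ℝ v) hext)
    (hint _ _ hΦ.continuous subset_rfl (hg.continuousOn_fderiv v))
    (hint _ _ hΦ.continuous subset_rfl hext)
    (fun y _ => hΦ.differentiable one_ne_zero y) fun y hy => hg.differentiableAt (hne y hy)
  exact (hΦ.continuous_fderiv one_ne_zero).clm_apply continuous_const

section RadialWeight

variable {w : ℝ → ℝ}

theorem integral_mul_pd (hw : ContDiff ℝ 1 w) (hc : HasCompactSupport w) (h0 : 0 ∉ tsupport w)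
    {g : S2 → ℝ} (hg : C1 g) (i : Fin 3) :
    (∫ r in Set.Ioi (0 : ℝ), r * w r) * ∫ x, pd i g x ∂area
      = -((∫ r in Set.Ioi (0 : ℝ), r ^ 2 * deriv w r) * ∫ x, x.1 i * g x ∂area) := by
  have hsupp : tsupport (fun y : E3 => w ‖y‖) ⊆ norm ⁻¹' tsupport w :=
    tsupport_comp_subset_preimage (f := fun y : E3 => ‖y‖) w continuous_norm
  have hw0 : w =ᶠ[𝓝 0] 0 := notMem_tsupport_iff_eventuallyEq.1 h0
  have hΦ : ContDiff ℝ 1 fun y : E3 => w ‖y‖ := by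
    refine contDiff_iff_contDiffAt.2 fun y => ?_
    rcases eq_or_ne y 0 with rfl | hy
    · refine contDiffAt_const (c := 0) |>.congr_of_eventuallyEq ?_
      exact (continuous_norm.tendsto' (0 : E3) 0 norm_zero).eventually hw0
    · exact hw.contDiffAt.comp y (contDiffAt_norm ℝ hy)
  have hΦc : HasCompactSupport fun y : E3 => w ‖y‖ := by
    rw [hasCompactSupport_iff_eventuallyEq, coclosedCompact_eq_cocompact] at hc ⊢
    exact (tendsto_norm_cocompact_atTop.mono_right atTop_le_cocompact).eventually hc
  have hibp := integral_mul_fderiv_radialExt hΦ hΦc (fun h => h0 (by simpa using hsupp h)) hg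
    (EuclideanSpace.single i 1)
  have hleft (y : E3) : w ‖y‖ * fderiv ℝ (radialExt g) y (EuclideanSpace.single i 1)
      = w ‖y‖ * ‖y‖⁻¹ * radialExt (pd i g) y := by
    rcases eq_or_ne y 0 with rfl | hy
    · simp [hw0.self_of_nhds]
    · rw [radialExt_pd i g hy]
      field_simp
  have hright (y : E3) : fderiv ℝ (fun z : E3 => w ‖z‖) y (EuclideanSpace.single i 1)
        * radialExt g y = deriv w ‖y‖ * radialExt (fun x => x.1 i * g x) y := by
    rcases eq_or_ne y 0 with rfl | hy
    · simp only [radialExt_zero, mul_zero]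
    · have hchain : HasFDerivAt (fun z : E3 => w ‖z‖) _ y :=
        (hw.differentiable one_ne_zero _).hasDerivAt.comp_hasFDerivAt y (hasFDerivAt_norm hy)
      rw [hchain.fderiv, radialExt_of_ne _ hy, radialExt_of_ne _ hy]
      simp [radialProj, EuclideanSpace.inner_single_right, mul_assoc]
  simp only [hleft, hright, integral_norm_mul_radialExt (fun r => w r * r⁻¹),
    integral_norm_mul_radialExt (deriv w)] at hibp
  rw [← hibp]
  congr 1
  refine setIntegral_congr_fun measurableSet_Ioi fun r (hr : 0 < r) => ?_
  field_simp

theorem integral_sq_mul_deriv (hw : ContDiff ℝ 1 w) (hc : HasCompactSupport w) :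
    ∫ r in Set.Ioi (0 : ℝ), r ^ 2 * deriv w r = -(2 * ∫ r in Set.Ioi (0 : ℝ), r * w r) := by
  have hderiv (r : ℝ) : deriv (fun r => r ^ 2 * w r) r = 2 * (r * w r) + r ^ 2 * deriv w r := by
    rw [((hasDerivAt_pow 2 r).fun_mul (hw.differentiable one_ne_zero r).hasDerivAt).deriv]
    ring
  have hint := HasCompactSupport.integral_Ioi_deriv_eq ((contDiff_id.pow 2).mul hw)
    (hc.mul_left (f := fun r => r ^ 2)) 0
  have hprim : Integrable fun r => 2 * (r * w r) :=
    (Continuous.integrable_of_hasCompactSupport (continuous_id.mul hw.continuous)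
      hc.mul_left).const_mul 2
  have hder : Integrable fun r => r ^ 2 * deriv w r :=
    Continuous.integrable_of_hasCompactSupport
      ((continuous_id.pow 2).mul (hw.continuous_deriv le_rfl)) hc.deriv.mul_left
  change ∫ r in Set.Ioi (0 : ℝ), deriv (fun r => r ^ 2 * w r) r = _ at hint
  simp only [hderiv] at hint
  rw [integral_add hprim.integrableOn hder.integrableOn, integral_const_mul] at hint
  simp only [id_eq] at hint
  linarith

theorem exists_radial_weight : ∃ w : ℝ → ℝ, ContDiff ℝ 1 w ∧ HasCompactSupport w ∧
    0 ∉ tsupport w ∧ 0 < ∫ r in Set.Ioi (0 : ℝ), r * w r := by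
  let w : ContDiffBump (2 : ℝ) := ⟨1 / 2, 1, by norm_num, by norm_num⟩
  have hzero : ∀ r ≤ 0, w r = 0 := fun r hr => w.zero_of_le_dist <| by
    rw [Real.dist_eq, abs_of_neg (by linarith)]
    change 1 ≤ -(r - 2)
    linarith
  refine ⟨w, w.contDiff, w.hasCompactSupport, ?_, ?_⟩
  · rw [w.tsupport_eq, Metric.mem_closedBall, dist_comm]
    norm_num [w]
  · rw [setIntegral_eq_integral_of_forall_compl_eq_zero
      fun r hr => by rw [hzero r (not_lt.1 hr), mul_zero]]
    refine Continuous.integral_pos_of_hasCompactSupport_nonneg_nonzero (x := 2)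
      (continuous_id.mul w.continuous) w.hasCompactSupport.mul_left (fun r => ?_) ?_
    · rcases le_total r 0 with hr | hr
      · exact (mul_eq_zero_of_right r (hzero r hr)).ge
      · exact mul_nonneg hr w.nonneg
    · have h2 : w 2 = 1 := w.one_of_mem_closedBall (Metric.mem_closedBall_self (by norm_num [w]))
      change 2 * w 2 ≠ 0
      rw [h2]
      norm_num

end RadialWeight

-- Integrate the divergence of `w(‖y‖) g(y / ‖y‖) eᵢ` over `ℝ³` for a radial weight `w`.
theorem integral_pd {g : S2 → ℝ} (hg : C1 g) (i : Fin 3) :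
    ∫ x, pd i g x ∂area = 2 * ∫ x, x.1 i * g x ∂area := by
  obtain ⟨w, hw, hc, h0, hpos⟩ := exists_radial_weight
  have h := integral_mul_pd hw hc h0 hg i
  rw [integral_sq_mul_deriv hw hc] at h
  refine mul_left_cancel₀ hpos.ne' ?_
  linarith

/-! ### Covariant derivatives of tangential tensors -/

section Metric

variable (x : S2)

theorem σ_symm (i j : Fin 3) : σ x i j = σ x j i := by
  simp only [σ, eq_comm, mul_comm]

theorem sum_σ_mul (j : Fin 3) (v : Fin 3 → ℝ) :
    ∑ i, σ x i j * v i = v j - x.1 j * ∑ i, x.1 i * v i := by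
  simp only [σ, sub_mul, Finset.sum_sub_distrib, ite_mul, one_mul, zero_mul, Finset.sum_ite_eq',
    Finset.mem_univ, if_true, Finset.mul_sum, mul_comm _ (x.1 j), mul_assoc]

theorem sum_σ_mul_of_tangential (j : Fin 3) {v : Fin 3 → ℝ} (hv : ∑ i, x.1 i * v i = 0) :
    ∑ i, σ x i j * v i = v j := by
  rw [sum_σ_mul, hv, mul_zero, sub_zero]

theorem sum_coord_mul_σ (j : Fin 3) : ∑ i, x.1 i * σ x i j = 0 := by
  have h := sum_σ_mul x j fun i => x.1 i
  rw [S2.sum_coord_mul_self, mul_one, sub_self] at h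
  simpa only [mul_comm] using h

theorem sum_σ_self : ∑ i, σ x i i = 2 := by
  simp only [σ, if_true, Finset.sum_sub_distrib, S2.sum_coord_mul_self]
  norm_num

theorem sum_grad_X_mul (k : Fin 3) {v : Fin 3 → ℝ} (hv : ∑ i, x.1 i * v i = 0) :
    ∑ i, grad (X k) x i * v i = v k := by
  rw [← sum_σ_mul_of_tangential x k hv]
  exact Finset.sum_congr rfl fun i _ => congrArg (· * v i) (pd_coord i k x)

end Metric

theorem smoothOnS2_σ (i j : Fin 3) : SmoothOnS2 fun x => σ x i j :=
  (SmoothOnS2.const _).sub ((smoothOnS2_coord i).mul (smoothOnS2_coord j))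

theorem sum_σ_mul_pd {g : S2 → ℝ} (hg : C1 g) (x : S2) (j : Fin 3) :
    ∑ i, σ x i j * pd i g x = pd j g x :=
  sum_σ_mul_of_tangential x j (sum_coord_mul_pd hg x)

theorem C1.mul {g h : S2 → ℝ} (hg : C1 g) (hh : C1 h) : C1 fun y => g y * h y :=
  ContMDiff.mul hg hh

theorem C1.const_mul {g : S2 → ℝ} (hg : C1 g) (c : ℝ) : C1 fun y => c * g y :=
  contMDiff_const.mul hg

theorem C1.coord_mul {g : S2 → ℝ} (hg : C1 g) (j : Fin 3) : C1 fun y => y.1 j * g y :=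
  (smoothOnS2_coord j).c1.mul hg

theorem pd_coord_mul {g : S2 → ℝ} (hg : C1 g) (i j : Fin 3) (x : S2) :
    pd i (fun y => y.1 j * g y) x = σ x i j * g x + x.1 j * pd i g x := by
  rw [pd_mul i (smoothOnS2_coord j).c1 hg, pd_coord]

section Forms

variable {w : S2 → Fin 3 → ℝ} (hw : ∀ l, C1 fun y => w y l)
include hw

theorem divForm_eq (x : S2) : divForm w x = ∑ l, pd l (fun y => w y l) x := by
  simp only [divForm, covForm]
  rw [Finset.sum_comm]
  exact Finset.sum_congr rfl fun l _ => sum_σ_mul_pd (hw l) x l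

theorem sum_coord_mul_pd_of_tangential (ht : ∀ x, ∑ l, x.1 l * w x l = 0) (i : Fin 3) (x : S2) :
    ∑ l, x.1 l * pd i (fun y => w y l) x = -w x i := by
  have h : pd i (fun y => ∑ l, y.1 l * w y l) x = 0 := by simp only [ht, pd_const]
  rw [pd_sum _ _ fun l _ => (hw l).coord_mul l] at h
  simp only [pd_coord_mul (hw _), Finset.sum_add_distrib, σ_symm x i,
    sum_σ_mul_of_tangential x i (ht x)] at h
  linarith

theorem covForm_eq (ht : ∀ x, ∑ l, x.1 l * w x l = 0) (x : S2) (i j : Fin 3) :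
    covForm w x i j = pd i (fun y => w y j) x + x.1 j * w x i := by
  simp only [covForm, σ_symm x j]
  rw [sum_σ_mul, sum_coord_mul_pd_of_tangential hw ht, mul_neg, sub_neg_eq_add]

theorem covForm_tangential_left (x : S2) (j : Fin 3) : ∑ i, x.1 i * covForm w x i j = 0 := by
  simp only [covForm, Finset.mul_sum]
  rw [Finset.sum_comm]
  refine Finset.sum_eq_zero fun l _ => ?_
  simp only [mul_left_comm _ (σ x j l), ← Finset.mul_sum, sum_coord_mul_pd (hw l), mul_zero]

end Forms

theorem covForm_tangential_right (w : S2 → Fin 3 → ℝ) (x : S2) (i : Fin 3) :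
    ∑ j, x.1 j * covForm w x i j = 0 := by
  simp only [covForm, Finset.mul_sum]
  rw [Finset.sum_comm]
  refine Finset.sum_eq_zero fun l _ => ?_
  simp only [← mul_assoc, ← Finset.sum_mul, sum_coord_mul_σ, zero_mul]

theorem divTensor_tangential (T : S2 → Fin 3 → Fin 3 → ℝ) (x : S2) :
    ∑ j, x.1 j * divTensor T x j = 0 := by
  have h (i a b : Fin 3) :
      ∑ j, x.1 j * (σ x i a * σ x j b * pd i (fun y => T y a b) x) = 0 := by
    calc _ = (∑ j, x.1 j * σ x j b) * (σ x i a * pd i (fun y => T y a b) x) := by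
          rw [Finset.sum_mul]
          exact Finset.sum_congr rfl fun j _ => by ring
      _ = 0 := by rw [sum_coord_mul_σ, zero_mul]
  simp only [divTensor, covTensor, Finset.mul_sum]
  rw [Finset.sum_comm]
  refine Finset.sum_eq_zero fun i _ => ?_
  rw [Finset.sum_comm]
  refine Finset.sum_eq_zero fun a _ => ?_
  rw [Finset.sum_comm]
  exact Finset.sum_eq_zero fun b _ => h i a b

theorem divTensor_eq {T : S2 → Fin 3 → Fin 3 → ℝ} (hT : ∀ a b, C1 fun y => T y a b)
    (ht : ∀ x a, ∑ b, x.1 b * T x a b = 0) (x : S2) (j : Fin 3) :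
    divTensor T x j = ∑ i, pd i (fun y => T y i j) x + x.1 j * ∑ i, T x i i := by
  have h : divTensor T x j = ∑ a, ∑ b, σ x b j * ∑ i, σ x i a * pd i (fun y => T y a b) x := by
    simp only [divTensor, covTensor, Finset.mul_sum]
    rw [Finset.sum_comm]
    refine Finset.sum_congr rfl fun a _ => ?_
    rw [Finset.sum_comm]
    refine Finset.sum_congr rfl fun b _ => Finset.sum_congr rfl fun i _ => ?_
    rw [σ_symm x b j]
    ring
  simp only [h, sum_σ_mul_pd (hT _ _)]
  rw [Finset.mul_sum, ← Finset.sum_add_distrib]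
  refine Finset.sum_congr rfl fun a _ => ?_
  rw [sum_σ_mul, sum_coord_mul_pd_of_tangential (hT a) (fun x => ht x a), mul_neg, sub_neg_eq_add]

section Hessian

variable {f : S2 → ℝ} (hf : SmoothOnS2 f)
include hf

theorem hess_eq (x : S2) (i j : Fin 3) : hess f x i j = pd i (pd j f) x + x.1 j * pd i f x :=
  covForm_eq (w := grad f) (fun l => (hf.pd l).c1) (sum_coord_mul_pd hf.c1) x i j

theorem lap_eq (x : S2) : lap f x = ∑ i, pd i (pd i f) x :=
  divForm_eq (w := grad f) (fun l => (hf.pd l).c1) x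

theorem hess_symm (x : S2) (i j : Fin 3) : hess f x i j = hess f x j i := by
  have h := pd_comm hf j i x
  rw [hess_eq hf, hess_eq hf]
  linarith

theorem smoothOnS2_hess (i j : Fin 3) : SmoothOnS2 fun x => hess f x i j := by
  simp only [hess_eq hf]
  exact ((hf.pd j).pd i).add ((smoothOnS2_coord j).mul (hf.pd i))

theorem smoothOnS2_lap : SmoothOnS2 (lap f) := by
  rw [funext (lap_eq hf)]
  exact contMDiff_finsetSum fun i _ => (hf.pd i).pd i

end Hessian

/-! ### Symmetric traceless tensors -/

-- The kernel vector leaves a symmetric traceless 2 × 2 block, whose square is pure trace.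
theorem sum_mul_self_of_traceless {v : Fin 3 → ℝ} (hv : ∑ i, v i * v i = 1)
    {M : Fin 3 → Fin 3 → ℝ} (hsymm : ∀ i j, M i j = M j i) (htr : ∑ i, M i i = 0)
    (hker : ∀ j, ∑ i, v i * M i j = 0) (k i : Fin 3) :
    ∑ d, M k d * M i d = 1 / 2 * pair M M * ((if k = i then 1 else 0) - v k * v i) := by
  have h0 := hker 0
  have h1 := hker 1
  have h2 := hker 2
  simp only [pair, Fin.sum_univ_three, hsymm 1 0, hsymm 2 0, hsymm 2 1] at hv htr h0 h1 h2 ⊢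
  clear hker
  fin_cases k <;> fin_cases i <;>
    simp only [Fin.zero_eta, Fin.mk_one, Fin.reduceFinMk, reduceIte, Fin.isValue, Fin.reduceEq,
      hsymm 1 0, hsymm 2 0, hsymm 2 1] <;> grind

/-- Smooth symmetric traceless tangential 2-tensors on the sphere. -/
structure IsSTF (T : S2 → Fin 3 → Fin 3 → ℝ) : Prop where
  smooth : ∀ i j, SmoothOnS2 fun x => T x i j
  tangential : ∀ x j, ∑ i, x.1 i * T x i j = 0
  symm : ∀ x i j, T x i j = T x j i
  traceless : ∀ x, ∑ i, T x i i = 0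

namespace IsSTF

variable {T : S2 → Fin 3 → Fin 3 → ℝ} (hT : IsSTF T)
include hT

theorem c1 (i j : Fin 3) : C1 fun x => T x i j := (hT.smooth i j).c1

theorem tangential_right (x : S2) (i : Fin 3) : ∑ j, x.1 j * T x i j = 0 := by
  simpa only [hT.symm x i] using hT.tangential x i

theorem divTensor_eq (x : S2) (j : Fin 3) : divTensor T x j = ∑ i, pd i (fun y => T y i j) x := by
  rw [NullInfinity.divTensor_eq hT.c1 hT.tangential_right, hT.traceless, mul_zero, add_zero]

theorem smoothOnS2_divTensor (j : Fin 3) : SmoothOnS2 fun x => divTensor T x j := by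
  simp only [hT.divTensor_eq]
  exact contMDiff_finsetSum fun i _ => (hT.smooth i j).pd i

theorem sum_mul_self (x : S2) (k i : Fin 3) :
    ∑ d, T x k d * T x i d = 1 / 2 * pair (T x) (T x) * σ x k i :=
  sum_mul_self_of_traceless x.sum_coord_mul_self (hT.symm x) (hT.traceless x) (hT.tangential x) k i

theorem add {S : S2 → Fin 3 → Fin 3 → ℝ} (hS : IsSTF S) : IsSTF fun x i j => T x i j + S x i j where
  smooth i j := (hT.smooth i j).add (hS.smooth i j)
  tangential x j := by
    simp only [mul_add, Finset.sum_add_distrib, hT.tangential, hS.tangential, add_zero]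
  symm x i j := by rw [hT.symm, hS.symm]
  traceless x := by
    simp only [Finset.sum_add_distrib, hT.traceless, hS.traceless, add_zero]

theorem divTensor_add {S : S2 → Fin 3 → Fin 3 → ℝ} (hS : IsSTF S) (x : S2) (j : Fin 3) :
    divTensor (fun x i j => T x i j + S x i j) x j = divTensor T x j + divTensor S x j := by
  simp only [(hT.add hS).divTensor_eq, hT.divTensor_eq, hS.divTensor_eq, pd_add _ (hT.c1 _ j)
    (hS.c1 _ j), Finset.sum_add_distrib]

theorem divForm_sum_mul_pd {f : S2 → ℝ} (hf : SmoothOnS2 f) (x : S2) :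
    divForm (fun y j => ∑ i, T y i j * pd i f y) x
      = ∑ i, divTensor T x i * pd i f x + pair (T x) (hess f x) := by
  have hp (i : Fin 3) := (hf.pd i).c1
  have hnormal : ∑ i, ∑ j, T x i j * (x.1 j * pd i f x) = 0 := by
    simp only [← mul_assoc, mul_comm (T x _ _) (x.1 _), ← Finset.sum_mul, hT.tangential_right,
      zero_mul, Finset.sum_const_zero]
  have hTp (i j : Fin 3) := (hT.c1 i j).mul (hp i)
  rw [divForm_eq fun j => contMDiff_finsetSum fun i _ => hTp i j]
  simp only [pd_sum _ _ fun i _ => hTp i _, pd_mul _ (hT.c1 _ _) (hp _),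
    Finset.sum_add_distrib, pair, hess_eq hf, mul_add, hnormal, add_zero, hT.divTensor_eq,
    Finset.sum_mul]
  rw [Finset.sum_comm]
  simp only [hT.symm]

end IsSTF

section ShearShift

/-- The change of the shear under the supertranslation `f`. -/
def shearShift (f : S2 → ℝ) (x : S2) (i j : Fin 3) : ℝ := -2 * hess f x i j + lap f x * σ x i j

variable {f : S2 → ℝ} (hf : SmoothOnS2 f)
include hf

theorem isSTF_shearShift : IsSTF (shearShift f) where
  smooth i j := ((SmoothOnS2.const _).mul (smoothOnS2_hess hf i j)).add
    ((smoothOnS2_lap hf).mul (smoothOnS2_σ i j))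
  tangential x j := by
    have hhess : ∑ i, x.1 i * hess f x i j = 0 :=
      covForm_tangential_left (w := grad f) (fun l => (hf.pd l).c1) x j
    simp only [shearShift, mul_add, mul_left_comm (x.1 _), Finset.sum_add_distrib,
      ← Finset.mul_sum, hhess, sum_coord_mul_σ, mul_zero, add_zero]
  symm x i j := by rw [shearShift, shearShift, hess_symm hf, σ_symm]
  traceless x := by
    have hhess : ∑ i, hess f x i i = lap f x := rfl
    simp only [shearShift, Finset.sum_add_distrib, ← Finset.mul_sum, hhess, sum_σ_self]
    ring

theorem sum_pd_pd_pd (x : S2) (j : Fin 3) :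
    ∑ i, pd i (pd i (pd j f)) x = pd j (lap f) x - 2 * x.1 j * lap f x := by
  have hswap (i : Fin 3) : pd i (pd j f)
      = fun y => pd j (pd i f) y + (y.1 i * pd j f y - y.1 j * pd i f y) := by
    funext y
    linarith [pd_comm hf j i y]
  have hterm (i : Fin 3) : pd i (pd i (pd j f)) x = pd j (pd i (pd i f)) x
      + x.1 i * pd j (pd i f) x - 2 * x.1 j * pd i (pd i f) x
      + σ x i i * pd j f x + x.1 i * pd i (pd j f) x - σ x i j * pd i f x := by
    have hi := ((hf.pd j).c1.coord_mul i)
    have hj := ((hf.pd i).c1.coord_mul j)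
    have h := congrArg (fun g => pd i g x) (hswap i)
    simp only [pd_add i ((hf.pd i).pd j).c1 (hi.sub hj), pd_sub i hi hj,
      pd_coord_mul (hf.pd _).c1] at h
    linarith [pd_comm (hf.pd i) j i x]
  have hlap : ∑ i, pd j (pd i (pd i f)) x = pd j (lap f) x := by
    rw [funext (lap_eq hf), pd_sum _ _ fun i _ => ((hf.pd i).pd i).c1]
  have hgrad : ∑ i, x.1 i * pd j (pd i f) x = -pd j f x :=
    sum_coord_mul_pd_of_tangential (w := grad f) (fun l => (hf.pd l).c1)
      (sum_coord_mul_pd hf.c1) j x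
  simp only [hterm, Finset.sum_add_distrib, Finset.sum_sub_distrib, ← Finset.mul_sum,
    ← Finset.sum_mul, hlap, hgrad, sum_coord_mul_pd (hf.pd j).c1, sum_σ_mul_pd hf.c1, sum_σ_self,
    ← lap_eq hf]
  ring

theorem sum_pd_hess (x : S2) (j : Fin 3) :
    ∑ i, pd i (fun y => hess f y i j) x = pd j (lap f) x + pd j f x - x.1 j * lap f x := by
  simp only [hess_eq hf, pd_add _ ((hf.pd j).pd _).c1 ((hf.pd _).c1.coord_mul j),
    pd_coord_mul (hf.pd _).c1, Finset.sum_add_distrib, ← Finset.mul_sum, sum_pd_pd_pd hf,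
    sum_σ_mul_pd hf.c1, ← lap_eq hf]
  ring

omit hf in
theorem sum_pd_mul_σ {g : S2 → ℝ} (hg : C1 g) (x : S2) (j : Fin 3) :
    ∑ i, pd i (fun y => g y * σ y i j) x = pd j g x - 2 * x.1 j * g x := by
  have hσ (i : Fin 3) : pd i (fun y => σ y i j) x = -(σ x i i * x.1 j + x.1 i * σ x i j) := by
    have hj := (smoothOnS2_coord j).c1
    simp only [σ, pd_sub i contMDiff_const (hj.coord_mul i), pd_const, pd_coord_mul hj, pd_coord]
    ring
  simp only [pd_mul _ hg (smoothOnS2_σ _ j).c1, hσ, mul_comm (pd _ g x), Finset.sum_add_distrib,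
    sum_σ_mul_pd hg, ← Finset.mul_sum, Finset.sum_neg_distrib, ← Finset.sum_mul, sum_σ_self,
    sum_coord_mul_σ]
  ring

theorem divTensor_shearShift (x : S2) (j : Fin 3) :
    divTensor (shearShift f) x j = -pd j (lap f) x - 2 * pd j f x := by
  have hhess (i : Fin 3) := (smoothOnS2_hess hf i j).c1
  have hlap := (smoothOnS2_lap hf).c1
  rw [(isSTF_shearShift hf).divTensor_eq]
  simp only [shearShift]
  simp only [pd_add _ ((hhess _).const_mul _) (hlap.mul (smoothOnS2_σ _ j).c1),
    pd_const_mul _ _ (hhess _), Finset.sum_add_distrib, ← Finset.mul_sum, sum_pd_hess hf,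
    sum_pd_mul_σ hlap]
  ring

end ShearShift

/-! ### Integral identities on the sphere -/

theorem integral_sum_pd_of_tangential {w : S2 → Fin 3 → ℝ} (hw : ∀ i, C1 fun x => w x i)
    (ht : ∀ x, ∑ i, x.1 i * w x i = 0) : ∫ x, ∑ i, pd i (fun y => w y i) x ∂area = 0 := by
  rw [integral_finsetSum _ fun i _ => integrable_of_continuous ((hw i).continuous_pd i)]
  simp only [integral_pd (hw _)]
  rw [← Finset.mul_sum, ← integral_finsetSum _ fun i _ =>
    integrable_of_continuous ((hw i).coord_mul i).continuous]
  simp only [ht, integral_zero, mul_zero]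

theorem integral_pd_sub {q : S2 → ℝ} (hq : C1 q) (k : Fin 3) :
    ∫ x, (pd k q x - 2 * (x.1 k * q x)) ∂area = 0 := by
  rw [integral_sub (integrable_of_continuous (hq.continuous_pd k))
    ((integrable_of_continuous (hq.coord_mul k).continuous).const_mul 2), integral_const_mul,
    integral_pd hq, sub_self]

/-- The function `X̃^k f + ∇^A X̃^k ∇_A f`, half of the coefficient of `δm` in the change of the
center of mass flux under the supertranslation `f`. -/
def translationKernel (k : Fin 3) (f : S2 → ℝ) (x : S2) : ℝ := x.1 k * f x + pd k f x

section TranslationKernel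

variable {f : S2 → ℝ} (hf : SmoothOnS2 f)
include hf

theorem smoothOnS2_translationKernel (k : Fin 3) : SmoothOnS2 (translationKernel k f) :=
  ((smoothOnS2_coord k).mul hf).add (hf.pd k)

theorem pd_translationKernel (i k : Fin 3) (x : S2) :
    pd i (translationKernel k f) x = f x * σ x i k + hess f x i k := by
  change pd i (fun y => y.1 k * f y + pd k f y) x = _
  rw [pd_add i (hf.c1.coord_mul k) (hf.pd k).c1, pd_coord_mul hf.c1,
    hess_eq hf]
  ring

theorem integral_shearShift_mul_divTensor {T : S2 → Fin 3 → Fin 3 → ℝ} (hT : IsSTF T)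
    (k : Fin 3) :
    ∫ x, (∑ j, (shearShift f x k j * divTensor T x j - T x k j * divTensor (shearShift f) x j)
      - 2 * translationKernel k f x * ∑ j, pd j (fun y => divTensor T y j) x) ∂area = 0 := by
  let ψ : S2 → ℝ := fun x => 2 * f x + lap f x
  have hφ := (smoothOnS2_translationKernel hf k).c1
  have hlap := (smoothOnS2_lap hf).c1
  have h2f := hf.c1.const_mul 2
  have hψ : C1 ψ := h2f.add hlap
  have hdiv (i : Fin 3) := (hT.smoothOnS2_divTensor i).c1
  have hφdiv (i : Fin 3) : C1 fun x => translationKernel k f x * divTensor T x i := hφ.mul (hdiv i)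
  have hψT (i : Fin 3) : C1 fun x => ψ x * T x i k := hψ.mul (hT.c1 i k)
  let w : S2 → Fin 3 → ℝ := fun x i =>
    -2 * (translationKernel k f x * divTensor T x i) + ψ x * T x i k
  have hw (i : Fin 3) : C1 fun x => w x i := ((hφdiv i).const_mul _).add (hψT i)
  have ht (x : S2) : ∑ i, x.1 i * w x i = 0 := by
    simp only [w, mul_add, mul_left_comm (x.1 _), Finset.sum_add_distrib, ← Finset.mul_sum,
      divTensor_tangential, hT.tangential, mul_zero, add_zero]
  have hgradφ (x : S2) (i : Fin 3) :
      -2 * pd i (translationKernel k f) x = shearShift f x k i - ψ x * σ x i k := by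
    rw [pd_translationKernel hf, shearShift, hess_symm hf x k, σ_symm x k]
    ring
  have hgradψ (x : S2) (i : Fin 3) : pd i ψ x = -divTensor (shearShift f) x i := by
    rw [divTensor_shearShift hf, pd_add i h2f hlap, pd_const_mul i 2 hf.c1]
    ring
  have hdivw (x : S2) (i : Fin 3) : pd i (fun y => w y i) x
      = shearShift f x k i * divTensor T x i - T x k i * divTensor (shearShift f) x i
        - 2 * translationKernel k f x * pd i (fun y => divTensor T y i) x
        + ψ x * (pd i (fun y => T y i k) x - σ x i k * divTensor T x i) := by
    rw [pd_add i ((hφdiv i).const_mul _) (hψT i), pd_const_mul i _ (hφdiv i),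
      pd_mul i hφ (hdiv i), pd_mul i hψ (hT.c1 i k), hgradψ, hT.symm x k i]
    linear_combination divTensor T x i * hgradφ x i
  rw [← integral_sum_pd_of_tangential hw ht]
  refine integral_congr_ae (ae_of_all _ fun x => ?_)
  simp only [hdivw, Finset.sum_add_distrib, Finset.sum_sub_distrib, ← Finset.mul_sum,
    sum_σ_mul_of_tangential x k (divTensor_tangential T x), ← hT.divTensor_eq, sub_self, mul_zero,
    add_zero]

end TranslationKernel

theorem integral_intervalIntegral_comm {F : ℝ → S2 → ℝ}
    (hF : Continuous fun p : ℝ × S2 => F p.1 p.2) (a b : ℝ) :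
    ∫ x, (∫ s in a..b, F s x) ∂area = ∫ s in a..b, (∫ x, F s x ∂area) := by
  refine (intervalIntegral_integral_swap ?_).symm
  have hcompact : IsCompact (Set.uIcc a b ×ˢ (Set.univ : Set S2)) :=
    isCompact_uIcc.prod isCompact_univ
  have hint := (hF.continuousOn.integrableOn_compact (μ := volume.prod area) hcompact).mono_set
    (Set.prod_mono_left Set.uIoc_subset_uIcc)
  rwa [IntegrableOn, ← Measure.prod_restrict, Measure.restrict_univ] at hint

section Tensors

variable {T : S2 → Fin 3 → Fin 3 → ℝ}

theorem continuous_divTensor (hT : ∀ i j, C1 fun x => T x i j)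
    (ht : ∀ x i, ∑ j, x.1 j * T x i j = 0) (k : Fin 3) : Continuous fun x => divTensor T x k := by
  simp only [divTensor_eq hT ht]
  exact (continuous_finsetSum _ fun i _ => (hT i k).continuous_pd i).add
    ((smoothOnS2_coord k).continuous.mul (continuous_finsetSum _ fun i _ => (hT i i).continuous))

theorem integral_divTensor_sub (hT : ∀ i j, C1 fun x => T x i j)
    (htl : ∀ x j, ∑ i, x.1 i * T x i j = 0) (htr : ∀ x i, ∑ j, x.1 j * T x i j = 0) (k : Fin 3) :
    ∫ x, (divTensor T x k - x.1 k * ∑ i, T x i i) ∂area = 0 := by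
  simp only [divTensor_eq hT htr, add_sub_cancel_right]
  exact integral_sum_pd_of_tangential (fun i => hT i k) fun x => htl x k

theorem IsSTF.integral_coord_mul_divForm_divTensor (hT : IsSTF T) (k : Fin 3) :
    ∫ x, x.1 k * divForm (divTensor T) x ∂area = 0 := by
  have hdiv (i : Fin 3) := (hT.smoothOnS2_divTensor i).c1
  have hw (i : Fin 3) : C1 fun x => x.1 k * divTensor T x i - T x i k :=
    ((hdiv i).coord_mul k).sub (hT.c1 i k)
  have ht (x : S2) : ∑ i, x.1 i * (x.1 k * divTensor T x i - T x i k) = 0 := by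
    simp only [mul_sub, mul_left_comm _ (x.1 k), Finset.sum_sub_distrib, ← Finset.mul_sum,
      divTensor_tangential, hT.tangential, mul_zero, sub_zero]
  rw [← integral_sum_pd_of_tangential hw ht]
  refine integral_congr_ae (ae_of_all _ fun x => ?_)
  simp only [pd_sub _ ((hdiv _).coord_mul k) (hT.c1 _ k), pd_coord_mul (hdiv _),
    Finset.sum_add_distrib, Finset.sum_sub_distrib,
    sum_σ_mul_of_tangential x k (divTensor_tangential T x), ← hT.divTensor_eq, ← Finset.mul_sum,
    divForm_eq hdiv, add_sub_cancel_left]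

end Tensors

section Curl

/-- The antisymmetrized derivative `∇_i w_j - ∇_j w_i`. -/
def curl (w : S2 → Fin 3 → ℝ) (x : S2) (i j : Fin 3) : ℝ := covForm w x i j - covForm w x j i

variable {w : S2 → Fin 3 → ℝ} (hw : ∀ l, SmoothOnS2 fun x => w x l)
include hw

theorem smoothOnS2_covForm (i j : Fin 3) : SmoothOnS2 fun x => covForm w x i j :=
  contMDiff_finsetSum fun l _ => (smoothOnS2_σ j l).mul ((hw l).pd i)

theorem smoothOnS2_curl (i j : Fin 3) : SmoothOnS2 fun x => curl w x i j :=
  (smoothOnS2_covForm hw i j).sub (smoothOnS2_covForm hw j i)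

theorem curl_tangential_left (x : S2) (j : Fin 3) : ∑ i, x.1 i * curl w x i j = 0 := by
  simp only [curl, mul_sub, Finset.sum_sub_distrib, covForm_tangential_right,
    covForm_tangential_left fun l => (hw l).c1, sub_zero]

theorem curl_tangential_right (x : S2) (i : Fin 3) : ∑ j, x.1 j * curl w x i j = 0 := by
  simp only [curl, mul_sub, Finset.sum_sub_distrib, covForm_tangential_right,
    covForm_tangential_left fun l => (hw l).c1, sub_zero]

theorem continuous_divTensor_curl (k : Fin 3) : Continuous fun x => divTensor (curl w) x k :=
  continuous_divTensor (fun i j => (smoothOnS2_curl hw i j).c1) (curl_tangential_right hw) k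

theorem integral_divTensor_curl (k : Fin 3) : ∫ x, divTensor (curl w) x k ∂area = 0 := by
  simpa [curl] using integral_divTensor_sub (fun i j => (smoothOnS2_curl hw i j).c1)
    (curl_tangential_left hw) (curl_tangential_right hw) k

end Curl

section Contract

/-- The contraction `S_i^d T_{dj}`. -/
def contract (S T : S2 → Fin 3 → Fin 3 → ℝ) (x : S2) (i j : Fin 3) : ℝ := ∑ d, S x i d * T x d j

variable {S T : S2 → Fin 3 → Fin 3 → ℝ}

theorem contract_tangential_right (hT : IsSTF T) (x : S2) (i : Fin 3) :
    ∑ j, x.1 j * contract S T x i j = 0 := by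
  simp only [contract, Finset.mul_sum]
  rw [Finset.sum_comm]
  simp only [mul_left_comm _ (S x i _), ← Finset.mul_sum, hT.tangential_right, mul_zero,
    Finset.sum_const_zero]

variable (hS : IsSTF S) (hT : IsSTF T)
include hS hT

theorem c1_contract (i j : Fin 3) : C1 fun x => contract S T x i j :=
  contMDiff_finsetSum fun d _ => (hS.c1 i d).mul (hT.c1 d j)

theorem continuous_divTensor_contract (k : Fin 3) :
    Continuous fun x => divTensor (contract S T) x k :=
  continuous_divTensor (c1_contract hS hT) (contract_tangential_right hT) k

theorem integral_divTensor_contract_sub (k : Fin 3) :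
    ∫ x, (divTensor (contract S T) x k - x.1 k * pair (S x) (T x)) ∂area = 0 := by
  have htl (x : S2) (j : Fin 3) : ∑ i, x.1 i * contract S T x i j = 0 := by
    simp only [contract, Finset.mul_sum]
    rw [Finset.sum_comm]
    simp only [← mul_assoc, ← Finset.sum_mul, hS.tangential, zero_mul, Finset.sum_const_zero]
  rw [← integral_divTensor_sub (c1_contract hS hT) htl (contract_tangential_right hT) k]
  simp only [contract, pair, hT.symm]

end Contract

/-! ### The rate of change of the center of mass -/

section SmoothOnScri

theorem smoothOnScri_time : SmoothOnScri fun u _ => u := contMDiff_fst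

theorem SmoothOnScri.pair {S T : ℝ → S2 → Fin 3 → Fin 3 → ℝ}
    (hS : ∀ i j, SmoothOnScri fun u x => S u x i j)
    (hT : ∀ i j, SmoothOnScri fun u x => T u x i j) :
    SmoothOnScri fun u x => pair (S u x) (T u x) :=
  SmoothOnScri.sum fun i _ => SmoothOnScri.sum fun j _ => (hS i j).mul (hT i j)

theorem SmoothOnScri.covForm {w : ℝ → S2 → Fin 3 → ℝ} (hw : ∀ l, SmoothOnScri fun u x => w u x l)
    (i j : Fin 3) : SmoothOnScri fun u x => covForm (w u) x i j :=
  SmoothOnScri.sum fun l _ => (smoothOnS2_σ j l).smoothOnScri.mul ((hw l).pd i)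

theorem SmoothOnScri.divTensor {T : ℝ → S2 → Fin 3 → Fin 3 → ℝ}
    (hT : ∀ i j, SmoothOnScri fun u x => T u x i j) (j : Fin 3) :
    SmoothOnScri fun u x => divTensor (T u) x j :=
  SmoothOnScri.sum fun i _ => SmoothOnScri.sum fun a _ => SmoothOnScri.sum fun b _ =>
    ((smoothOnS2_σ i a).smoothOnScri.mul (smoothOnS2_σ j b).smoothOnScri).mul ((hT a b).pd i)

variable {g : ℝ → S2 → ℝ} (hg : SmoothOnScri g)
include hg

theorem SmoothOnScri.continuous_line (x : S2) : Continuous fun u => g u x :=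
  hg.continuous.comp (continuous_id.prodMk continuous_const)

theorem SmoothOnScri.integrable (u : ℝ) : Integrable (g u) area :=
  integrable_of_continuous (ContMDiff.continuous (hg.slice u))

theorem SmoothOnScri.intervalIntegral_deriv (a b : ℝ) (x : S2) :
    ∫ s in a..b, _root_.deriv (fun s => g s x) s = g b x - g a x :=
  intervalIntegral.integral_eq_sub_of_hasDerivAt (fun s _ => hg.hasDerivAt s x)
    ((hg.deriv.continuous_line x).intervalIntegrable _ _)

end SmoothOnScri

section TimeDependentTensors

/-- The tensor field `∂_u T`. -/
def timeDeriv (T : ℝ → S2 → Fin 3 → Fin 3 → ℝ) (u : ℝ) (x : S2) (i j : Fin 3) : ℝ :=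
  deriv (fun s => T s x i j) u

variable {T : ℝ → S2 → Fin 3 → Fin 3 → ℝ} (hs : ∀ i j, SmoothOnScri fun u x => T u x i j)
include hs

theorem smooth_timeDeriv (i j : Fin 3) : SmoothOnScri fun u x => timeDeriv T u x i j :=
  (hs i j).deriv

theorem hasDerivAt_timeDeriv (u : ℝ) (x : S2) (i j : Fin 3) :
    HasDerivAt (fun s => T s x i j) (timeDeriv T u x i j) u := (hs i j).hasDerivAt u x

variable (hT : ∀ u, IsSTF (T u))
include hT

theorem isSTF_timeDeriv (u : ℝ) : IsSTF (timeDeriv T u) where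
  smooth i j := (smooth_timeDeriv hs i j).slice u
  tangential x j := by
    have h : HasDerivAt (fun s => ∑ i, x.1 i * T s x i j) (∑ i, x.1 i * timeDeriv T u x i j) u :=
      HasDerivAt.fun_sum fun i _ => (hasDerivAt_timeDeriv hs u x i j).const_mul _
    simp only [(hT _).tangential] at h
    exact h.unique (hasDerivAt_const u 0)
  symm x i j := by simp only [timeDeriv, (hT _).symm x i j]
  traceless x := by
    have h : HasDerivAt (fun s => ∑ i, T s x i i) (∑ i, timeDeriv T u x i i) u :=
      HasDerivAt.fun_sum fun i _ => hasDerivAt_timeDeriv hs u x i i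
    simp only [(hT _).traceless] at h
    exact h.unique (hasDerivAt_const u 0)

theorem hasDerivAt_divTensor (u : ℝ) (x : S2) (j : Fin 3) :
    HasDerivAt (fun s => divTensor (T s) x j) (divTensor (timeDeriv T u) x j) u := by
  simp only [(hT _).divTensor_eq, (isSTF_timeDeriv hs hT _).divTensor_eq]
  exact HasDerivAt.fun_sum fun i _ => (hs i j).hasDerivAt_pd i u x

variable {f : S2 → ℝ} (hf : SmoothOnS2 f)
include hf

theorem isSTF_shift (u : ℝ) : IsSTF fun x => T (u + f x) x where
  smooth i j := ((hs i j).shift hf).slice u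
  tangential x := (hT _).tangential x
  symm x := (hT _).symm x
  traceless x := (hT _).traceless x

theorem divTensor_shift (u : ℝ) (x : S2) (j : Fin 3) :
    divTensor (fun y => T (u + f y) y) x j = divTensor (T (u + f x)) x j
      + ∑ i, timeDeriv T (u + f x) x i j * pd i f x := by
  rw [(isSTF_shift hs hT hf u).divTensor_eq, (hT _).divTensor_eq, ← Finset.sum_add_distrib]
  exact Finset.sum_congr rfl fun i _ => (hs i j).pd_shift hf.c1 i u x

end TimeDependentTensors

namespace Data

variable {D : Data}

namespace IsVacuum

variable (hD : D.IsVacuum)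
include hD

theorem isSTF_C (u : ℝ) : IsSTF (D.C u) where
  smooth i j := (hD.smooth_C i j).slice u
  tangential := hD.tangential_C u
  symm := hD.symm_C u
  traceless := hD.traceless_C u

theorem smooth_news (i j : Fin 3) : SmoothOnScri fun u x => D.news u x i j :=
  (hD.smooth_C i j).deriv

theorem hasDerivAt_C (u : ℝ) (x : S2) (i j : Fin 3) :
    HasDerivAt (fun s => D.C s x i j) (D.news u x i j) u := hasDerivAt_timeDeriv hD.smooth_C u x i j

theorem isSTF_news (u : ℝ) : IsSTF (D.news u) := isSTF_timeDeriv hD.smooth_C hD.isSTF_C u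

theorem smooth_divC (j : Fin 3) : SmoothOnScri fun u x => divTensor (D.C u) x j :=
  SmoothOnScri.divTensor hD.smooth_C j

theorem hasDerivAt_divC (u : ℝ) (x : S2) (j : Fin 3) :
    HasDerivAt (fun s => divTensor (D.C s) x j) (divTensor (D.news u) x j) u :=
  hasDerivAt_divTensor hD.smooth_C hD.isSTF_C u x j

theorem hasDerivAt_pair_C (u : ℝ) (x : S2) :
    HasDerivAt (fun s => pair (D.C s x) (D.C s x)) (2 * pair (D.C u x) (D.news u x)) u := by
  have h : HasDerivAt (fun s => pair (D.C s x) (D.C s x))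
      (∑ i, ∑ j, (D.news u x i j * D.C u x i j + D.C u x i j * D.news u x i j)) u :=
    HasDerivAt.fun_sum fun i _ => HasDerivAt.fun_sum fun j _ =>
      (hD.hasDerivAt_C u x i j).mul (hD.hasDerivAt_C u x i j)
  refine h.congr_deriv ?_
  simp only [pair, Finset.mul_sum, two_mul, mul_comm (D.news u x _ _)]

end IsVacuum

/-- The 1-form `C_k^d ∇^b C_{db}`. -/
def shearStress (D : Data) (k : Fin 3) (u : ℝ) (x : S2) : ℝ :=
  ∑ d, D.C u x k d * divTensor (D.C u) x d

/-- The integrand of the center of mass. -/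
def comDensity (D : Data) (k : Fin 3) (u : ℝ) (x : S2) : ℝ :=
  D.NA u x k - u * pd k (D.m u) x - 1 / 4 * D.shearStress k u x
    - 1 / 16 * pd k (fun y => pair (D.C u y) (D.C u y)) x

/-- The density of the center of mass flux, up to the `u`-derivative of `shearStress` and total
derivatives on the sphere. -/
def fluxDensity (D : Data) (k : Fin 3) (u : ℝ) (x : S2) : ℝ :=
  u / 4 * (x.1 k * pair (D.news u x) (D.news u x))
    - 1 / 2 * ∑ d, D.news u x k d * divTensor (D.C u) x d

namespace IsVacuum

variable (hD : D.IsVacuum)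
include hD

theorem centerOfMass_eq (k : Fin 3) (u : ℝ) :
    D.centerOfMass k u = ∫ x, D.comDensity k u x ∂area := by
  refine integral_congr_ae (ae_of_all _ fun x => sum_grad_X_mul x k ?_)
  have hm : ∑ i, x.1 i * grad (D.m u) x i = 0 := sum_coord_mul_pd (hD.smooth_m.slice u).c1 x
  have hpair : ∑ i, x.1 i * grad (fun y => pair (D.C u y) (D.C u y)) x i = 0 :=
    sum_coord_mul_pd ((SmoothOnScri.pair hD.smooth_C hD.smooth_C).slice u).c1 x
  have hstress : ∑ i, x.1 i * ∑ d, D.C u x i d * divTensor (D.C u) x d = 0 := by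
    simp only [Finset.mul_sum]
    rw [Finset.sum_comm]
    simp only [← mul_assoc, ← Finset.sum_mul, hD.tangential_C, zero_mul, Finset.sum_const_zero]
  simp only [mul_sub, mul_left_comm (x.1 _) u, mul_left_comm (x.1 _) (1 / _),
    Finset.sum_sub_distrib, ← Finset.mul_sum, hD.tangential_NA, hm, hpair, hstress, mul_zero,
    sub_zero]

theorem smooth_shearStress (k : Fin 3) : SmoothOnScri (D.shearStress k) :=
  SmoothOnScri.sum fun d _ => (hD.smooth_C k d).mul (hD.smooth_divC d)

theorem smooth_comDensity (k : Fin 3) : SmoothOnScri (D.comDensity k) :=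
  (((hD.smooth_NA k).sub (smoothOnScri_time.mul (hD.smooth_m.pd k))).sub
    ((SmoothOnScri.const _).mul (hD.smooth_shearStress k))).sub
    ((SmoothOnScri.const _).mul ((SmoothOnScri.pair hD.smooth_C hD.smooth_C).pd k))

theorem smooth_fluxDensity (k : Fin 3) : SmoothOnScri (D.fluxDensity k) :=
  SmoothOnScri.sub
    (SmoothOnScri.mul (contMDiff_fst.div_const 4) ((smoothOnS2_coord k).smoothOnScri.mul
      (SmoothOnScri.pair hD.smooth_news hD.smooth_news)))
    ((SmoothOnScri.const _).mul
      (SmoothOnScri.sum fun d _ => (hD.smooth_news k d).mul (hD.smooth_divC d)))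

theorem hasDerivAt_shearStress (k : Fin 3) (u : ℝ) (x : S2) :
    HasDerivAt (fun s => D.shearStress k s x)
      (∑ d, (D.news u x k d * divTensor (D.C u) x d + D.C u x k d * divTensor (D.news u) x d)) u :=
  HasDerivAt.fun_sum fun d _ => (hD.hasDerivAt_C u x k d).mul (hD.hasDerivAt_divC u x d)

theorem hasDerivAt_comDensity (k : Fin 3) (u : ℝ) (x : S2) :
    HasDerivAt (fun s => D.comDensity k s x)
      (deriv (fun s => D.NA s x k) u
        - (pd k (D.m u) x + u * pd k (fun y => deriv (fun s => D.m s y) u) x)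
        - 1 / 4 * deriv (fun s => D.shearStress k s x) u
        - 1 / 8 * pd k (fun y => pair (D.C u y) (D.news u y)) x) u := by
  have hpair := (SmoothOnScri.pair hD.smooth_C hD.smooth_C).hasDerivAt_pd k u x
  simp only [(hD.hasDerivAt_pair_C u _).deriv] at hpair
  rw [pd_const_mul k 2 ((SmoothOnScri.pair hD.smooth_C hD.smooth_news).slice u).c1] at hpair
  refine (((((hD.smooth_NA k).hasDerivAt u x).sub ((hasDerivAt_id u).mul
    (hD.smooth_m.hasDerivAt_pd k u x))).sub (((hD.smooth_shearStress k).hasDerivAt u x).const_mul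
    (1 / 4))).sub (hpair.const_mul (1 / 16))).congr_deriv ?_
  simp only [id]
  ring

theorem deriv_comDensity_sub_eq (k : Fin 3) (u : ℝ) (x : S2) :
    deriv (fun s => D.comDensity k s x) u - 1 / 4 * deriv (fun s => D.shearStress k s x) u
        - D.fluxDensity k u x
      = 1 / 8 * (pd k (fun y => pair (D.C u y) (D.news u y)) x
          - 2 * (x.1 k * pair (D.C u x) (D.news u x)))
        - u * (pd k (fun y => deriv (fun s => D.m s y) u) x
          - 2 * (x.1 k * deriv (fun s => D.m s x) u))
        - u / 2 * (x.1 k * divForm (divTensor (D.news u)) x)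
        - 1 / 4 * divTensor (curl (divTensor (D.C u))) x k
        - 1 / 4 * (divTensor (contract (D.C u) (D.news u)) x k
          - x.1 k * pair (D.C u x) (D.news u x)) := by
  have hNA : deriv (fun s => D.NA s x k) u = pd k (D.m u) x
      - 1 / 4 * divTensor (curl (divTensor (D.C u))) x k
      + 1 / 4 * pd k (fun y => pair (D.C u y) (D.news u y)) x
      - 1 / 4 * divTensor (contract (D.C u) (D.news u)) x k
      + 1 / 2 * ∑ b, D.C u x k b * divTensor (D.news u) x b := hD.evolution_NA u x k
  rw [(hD.hasDerivAt_comDensity k u x).deriv, (hD.hasDerivAt_shearStress k u x).deriv, fluxDensity,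
    hNA, hD.evolution_m u x, Finset.sum_add_distrib]
  ring

theorem integral_deriv_comDensity_sub (k : Fin 3) (u : ℝ) :
    ∫ x, (deriv (fun s => D.comDensity k s x) u
      - 1 / 4 * deriv (fun s => D.shearStress k s x) u - D.fluxDensity k u x) ∂area = 0 := by
  have hC := hD.isSTF_C u
  have hN := hD.isSTF_news u
  have hq := ((SmoothOnScri.pair hD.smooth_C hD.smooth_news).slice u).c1
  have hm := (hD.smooth_m.deriv.slice u).c1
  have hint {g : S2 → ℝ} (hg : C1 g) : Integrable (fun x => pd k g x - 2 * (x.1 k * g x)) area :=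
    integrable_of_continuous ((hg.continuous_pd k).sub
      ((hg.coord_mul k).continuous.const_mul 2))
  have hdivdiv : Integrable (fun x => x.1 k * divForm (divTensor (D.news u)) x) area := by
    simp only [divForm_eq fun l => (hN.smoothOnS2_divTensor l).c1]
    exact integrable_of_continuous ((smoothOnS2_coord k).continuous.mul
      (continuous_finsetSum _ fun l _ => (hN.smoothOnS2_divTensor l).c1.continuous_pd l))
  have hcurl := integrable_of_continuous (continuous_divTensor_curl hC.smoothOnS2_divTensor k)
  have hcontract := integrable_of_continuous
    ((continuous_divTensor_contract hC hN k).sub (hq.coord_mul k).continuous)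
  simp only [hD.deriv_comDensity_sub_eq]
  have h₁ := ((hint hq).const_mul (1 / 8)).sub ((hint hm).const_mul u)
  have h₂ := h₁.sub (hdivdiv.const_mul (u / 2))
  have h₃ := h₂.sub (hcurl.const_mul (1 / 4))
  rw [integral_sub, integral_sub, integral_sub, integral_sub]
  · simp only [integral_const_mul, integral_pd_sub hq, integral_pd_sub hm,
      hN.integral_coord_mul_divForm_divTensor, integral_divTensor_curl hC.smoothOnS2_divTensor,
      integral_divTensor_contract_sub hC hN, mul_zero, sub_zero]
  exacts [(hint hq).const_mul _, (hint hm).const_mul _, h₁, hdivdiv.const_mul _, h₂,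
    hcurl.const_mul _, h₃, hcontract.const_mul _]

theorem centerOfMass_sub (k : Fin 3) (a b : ℝ) :
    D.centerOfMass k b - D.centerOfMass k a
      = ∫ x, ((∫ s in a..b, D.fluxDensity k s x)
        + 1 / 4 * (D.shearStress k b x - D.shearStress k a x)) ∂area := by
  have hq := hD.smooth_comDensity k
  have hs := hD.smooth_shearStress k
  have hf := hD.smooth_fluxDensity k
  let G : ℝ → S2 → ℝ := fun u x => deriv (fun s => D.comDensity k s x) u
    - 1 / 4 * deriv (fun s => D.shearStress k s x) u - D.fluxDensity k u x
  have hs' : SmoothOnScri fun u x => 1 / 4 * deriv (fun s => D.shearStress k s x) u :=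
    (SmoothOnScri.const _).mul hs.deriv
  have hG : SmoothOnScri G := (hq.deriv.sub hs').sub hf
  have hline {g : ℝ → S2 → ℝ} (hg : SmoothOnScri g) (x : S2) :
      IntervalIntegrable (fun u => g u x) volume a b :=
    (hg.continuous_line x).intervalIntegrable _ _
  have hGint : ∫ x, (∫ s in a..b, G s x) ∂area = 0 := by
    simp only [integral_intervalIntegral_comm hG.continuous, G, hD.integral_deriv_comDensity_sub,
      intervalIntegral.integral_zero]
  have hGline (x : S2) : ∫ s in a..b, G s x = (D.comDensity k b x - D.comDensity k a x)
      - ((∫ s in a..b, D.fluxDensity k s x)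
        + 1 / 4 * (D.shearStress k b x - D.shearStress k a x)) := by
    rw [intervalIntegral.integral_sub (hline (hq.deriv.sub hs') x) (hline hf x),
      intervalIntegral.integral_sub (hline hq.deriv x) (hline hs' x),
      intervalIntegral.integral_const_mul, hq.intervalIntegral_deriv, hs.intervalIntegral_deriv]
    ring
  have hflux : Continuous fun x => ∫ s in a..b, D.fluxDensity k s x :=
    intervalIntegral.continuous_parametric_intervalIntegral_of_continuous'
      (f := fun x s => D.fluxDensity k s x) (hf.continuous.comp continuous_swap) a b
  have hqint : Integrable (fun x => D.comDensity k b x - D.comDensity k a x) area :=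
    (hq.integrable b).sub (hq.integrable a)
  have hrhs : Integrable (fun x => (∫ s in a..b, D.fluxDensity k s x)
      + 1 / 4 * (D.shearStress k b x - D.shearStress k a x)) area :=
    (integrable_of_continuous hflux).add (((hs.integrable b).sub (hs.integrable a)).const_mul _)
  simp only [hGline] at hGint
  rw [integral_sub hqint hrhs,
    integral_sub (hq.integrable b) (hq.integrable a), ← hD.centerOfMass_eq,
    ← hD.centerOfMass_eq] at hGint
  exact sub_eq_zero.1 hGint

end IsVacuum

end Data

/-! ### Decay and limits along null infinity -/

/-- Uniform boundedness on `ℝ × S²`. -/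
def BoundedOnScri (g : ℝ → S2 → ℝ) : Prop := ∃ K : ℝ, ∀ u x, |g u x| ≤ K

namespace BoundedOnScri

variable {g h : ℝ → S2 → ℝ}

theorem add (hg : BoundedOnScri g) (hh : BoundedOnScri h) :
    BoundedOnScri fun u x => g u x + h u x :=
  let ⟨K, hK⟩ := hg
  let ⟨L, hL⟩ := hh
  ⟨K + L, fun u x => (abs_add_le _ _).trans (add_le_add (hK u x) (hL u x))⟩

theorem mul (hg : BoundedOnScri g) (hh : BoundedOnScri h) :
    BoundedOnScri fun u x => g u x * h u x := by
  obtain ⟨K, hK⟩ := hg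
  obtain ⟨L, hL⟩ := hh
  refine ⟨K * L, fun u x => ?_⟩
  rw [abs_mul]
  exact mul_le_mul (hK u x) (hL u x) (abs_nonneg _) ((abs_nonneg _).trans (hK u x))

theorem of_continuous {f : S2 → ℝ} (hf : Continuous f) : BoundedOnScri fun _ => f :=
  let ⟨K, hK⟩ := isCompact_univ.exists_bound_of_continuousOn hf.continuousOn
  ⟨K, fun _ x => hK x (Set.mem_univ x)⟩

theorem of_eventually (hg : Continuous fun p : ℝ × S2 => g p.1 p.2) {K R : ℝ}
    (h : ∀ u, R ≤ |u| → ∀ x, |g u x| ≤ K) : BoundedOnScri g := by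
  obtain ⟨M, hM⟩ := (isCompact_Icc (a := -R) (b := R)).prod (isCompact_univ (X := S2))
    |>.exists_bound_of_continuousOn hg.continuousOn
  refine ⟨max K M, fun u x => ?_⟩
  rcases le_total R |u| with hu | hu
  · exact (h u hu x).trans (le_max_left _ _)
  · exact (hM (u, x) ⟨abs_le.1 hu, Set.mem_univ x⟩).trans (le_max_right _ _)

end BoundedOnScri

/-- Uniform decay of order `|u|^{-1-ε}`. -/
def Decays (ε : ℝ) (g : ℝ → S2 → ℝ) : Prop :=
  BoundedOnScri fun u x => (1 + |u|) ^ (1 + ε) * g u x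

namespace Decays

variable {ε : ℝ} {g h : ℝ → S2 → ℝ}

theorem add (hg : Decays ε g) (hh : Decays ε h) : Decays ε fun u x => g u x + h u x := by
  simp only [Decays, mul_add]
  exact BoundedOnScri.add hg hh

theorem bounded_mul (hg : BoundedOnScri g) (hh : Decays ε h) :
    Decays ε fun u x => g u x * h u x := by
  simp only [Decays, mul_left_comm _ (g _ _)]
  exact hg.mul hh

theorem const_mul (c : ℝ) (hh : Decays ε h) : Decays ε fun u x => c * h u x :=
  bounded_mul (.of_continuous continuous_const) hh

theorem sum {ι : Type*} {s : Finset ι} {g : ι → ℝ → S2 → ℝ} (hg : ∀ i ∈ s, Decays ε (g i)) :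
    Decays ε fun u x => ∑ i ∈ s, g i u x := by
  classical
  induction s using Finset.induction_on with
  | empty => exact ⟨0, fun u x => by simp⟩
  | insert a s ha ih =>
    simp only [Finset.sum_insert ha]
    exact (hg a (Finset.mem_insert_self a s)).add
      (ih fun b hb => hg b (Finset.mem_insert_of_mem hb))

theorem exists_abs_le (hg : Decays ε g) :
    ∃ K, 0 ≤ K ∧ ∀ u x, |g u x| ≤ K * (1 + |u|) ^ (-(1 + ε)) := by
  obtain ⟨K, hK⟩ := hg
  refine ⟨max K 0, le_max_right _ _, fun u x => ?_⟩
  have hpos : 0 < (1 + |u|) ^ (1 + ε) := by positivity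
  rw [Real.rpow_neg (by positivity), ← div_eq_mul_inv, le_div_iff₀' hpos]
  calc (1 + |u|) ^ (1 + ε) * |g u x| = |(1 + |u|) ^ (1 + ε) * g u x| := by
        rw [abs_mul, abs_of_pos hpos]
    _ ≤ max K 0 := (hK u x).trans (le_max_left _ _)

theorem time_mul_bounded (hε : 0 < ε) (hg : Decays ε g) : BoundedOnScri fun u x => u * g u x := by
  obtain ⟨K, hK⟩ := hg
  refine ⟨K, fun u x => (le_trans ?_ (hK u x))⟩
  rw [abs_mul, abs_mul]
  refine mul_le_mul_of_nonneg_right ?_ (abs_nonneg _)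
  calc |u| ≤ (1 + |u|) ^ (1 : ℝ) := by rw [Real.rpow_one]; linarith
    _ ≤ (1 + |u|) ^ (1 + ε) :=
      Real.rpow_le_rpow_of_exponent_le (by linarith [abs_nonneg u]) (by linarith)
    _ ≤ |(1 + |u|) ^ (1 + ε)| := le_abs_self _

theorem bounded (hε : 0 < ε) (hg : Decays ε g) : BoundedOnScri g := by
  obtain ⟨K, hK⟩ := hg
  refine ⟨K, fun u x => (le_trans ?_ (hK u x))⟩
  rw [abs_mul]
  refine le_mul_of_one_le_left (abs_nonneg _) ((Real.one_le_rpow ?_ ?_).trans (le_abs_self _))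
  · linarith [abs_nonneg u]
  · linarith

theorem of_eventually (hε : 0 < ε) (hg : Continuous fun p : ℝ × S2 => g p.1 p.2) {K R : ℝ}
    (h : ∀ u, R ≤ |u| → 0 < |u| → ∀ x, |g u x| ≤ K * |u| ^ (-1 - ε)) : Decays ε g := by
  have hw : Continuous fun p : ℝ × S2 => (1 + |p.1|) ^ (1 + ε) :=
    (continuous_const.add continuous_fst.abs).rpow_const fun p => Or.inr (by linarith)
  refine BoundedOnScri.of_eventually (hw.mul hg) (K := 2 ^ (1 + ε) * K) (R := max R 1)
    fun u hu x => ?_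
  have hu1 : 1 ≤ |u| := (le_max_right _ _).trans hu
  have hu0 : 0 < |u| := one_pos.trans_le hu1
  have hwle : (1 + |u|) ^ (1 + ε) ≤ 2 ^ (1 + ε) * |u| ^ (1 + ε) := by
    rw [← Real.mul_rpow zero_le_two hu0.le]
    exact Real.rpow_le_rpow (by positivity) (by linarith) (by linarith)
  have hcancel : |u| ^ (1 + ε) * |u| ^ (-1 - ε) = 1 := by
    rw [← Real.rpow_add hu0, show 1 + ε + (-1 - ε) = 0 by ring, Real.rpow_zero]
  rw [abs_mul, abs_of_nonneg (by positivity)]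
  calc (1 + |u|) ^ (1 + ε) * |g u x|
      ≤ 2 ^ (1 + ε) * |u| ^ (1 + ε) * (K * |u| ^ (-1 - ε)) :=
        mul_le_mul hwle (h u ((le_max_left _ _).trans hu) hu0 x) (abs_nonneg _) (by positivity)
    _ = 2 ^ (1 + ε) * K * (|u| ^ (1 + ε) * |u| ^ (-1 - ε)) := by ring
    _ = 2 ^ (1 + ε) * K := by rw [hcancel, mul_one]

end Decays

/-- Pointwise convergence of a jointly continuous function to a continuous limit along the filter
`l` of retarded times, uniformly bounded so that it can be integrated over the sphere. -/
structure BoundedLimit (l : Filter ℝ) (g : ℝ → S2 → ℝ) (gl : S2 → ℝ) : Prop where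
  bounded : BoundedOnScri g
  continuous : Continuous fun p : ℝ × S2 => g p.1 p.2
  continuous_limit : Continuous gl
  tendsto : ∀ x, Tendsto (fun u => g u x) l (𝓝 (gl x))

namespace BoundedLimit

variable {l : Filter ℝ} {g h : ℝ → S2 → ℝ} {gl hl : S2 → ℝ}

theorem add (hg : BoundedLimit l g gl) (hh : BoundedLimit l h hl) :
    BoundedLimit l (fun u x => g u x + h u x) (fun x => gl x + hl x) where
  bounded := hg.bounded.add hh.bounded
  continuous := hg.continuous.add hh.continuous
  continuous_limit := hg.continuous_limit.add hh.continuous_limit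
  tendsto x := (hg.tendsto x).add (hh.tendsto x)

theorem mul (hg : BoundedLimit l g gl) (hh : BoundedLimit l h hl) :
    BoundedLimit l (fun u x => g u x * h u x) (fun x => gl x * hl x) where
  bounded := hg.bounded.mul hh.bounded
  continuous := hg.continuous.mul hh.continuous
  continuous_limit := hg.continuous_limit.mul hh.continuous_limit
  tendsto x := (hg.tendsto x).mul (hh.tendsto x)

theorem of_continuous {f : S2 → ℝ} (hf : Continuous f) : BoundedLimit l (fun _ => f) f where
  bounded := .of_continuous hf
  continuous := hf.comp continuous_snd
  continuous_limit := hf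
  tendsto _ := tendsto_const_nhds

theorem const_mul (c : ℝ) (hg : BoundedLimit l g gl) :
    BoundedLimit l (fun u x => c * g u x) (fun x => c * gl x) :=
  (of_continuous continuous_const).mul hg

theorem sub (hg : BoundedLimit l g gl) (hh : BoundedLimit l h hl) :
    BoundedLimit l (fun u x => g u x - h u x) (fun x => gl x - hl x) := by
  simpa only [neg_one_mul, ← sub_eq_add_neg] using hg.add (hh.const_mul (-1))

theorem sum {ι : Type*} {s : Finset ι} {g : ι → ℝ → S2 → ℝ} {gl : ι → S2 → ℝ}
    (hg : ∀ i ∈ s, BoundedLimit l (g i) (gl i)) :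
    BoundedLimit l (fun u x => ∑ i ∈ s, g i u x) (fun x => ∑ i ∈ s, gl i x) := by
  classical
  induction s using Finset.induction_on with
  | empty => exact of_continuous continuous_const
  | insert a s ha ih =>
    simp only [Finset.sum_insert ha]
    exact (hg a (Finset.mem_insert_self a s)).add
      (ih fun b hb => hg b (Finset.mem_insert_of_mem hb))

theorem shift (hl : ∀ c, Tendsto (fun u => u + c) l l) (hg : BoundedLimit l g gl) {f : S2 → ℝ}
    (hf : Continuous f) : BoundedLimit l (fun u x => g (u + f x) x) gl where
  bounded := let ⟨K, hK⟩ := hg.bounded; ⟨K, fun _ x => hK _ x⟩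
  continuous := hg.continuous.comp
    ((continuous_fst.add (hf.comp continuous_snd)).prodMk continuous_snd)
  continuous_limit := hg.continuous_limit
  tendsto x := (hg.tendsto x).comp (hl (f x))

theorem continuous_slice (hg : BoundedLimit l g gl) (u : ℝ) : Continuous (g u) :=
  hg.continuous.comp (continuous_const.prodMk continuous_id)

theorem tendsto_integral [l.IsCountablyGenerated] (hg : BoundedLimit l g gl) :
    Tendsto (fun u => ∫ x, g u x ∂area) l (𝓝 (∫ x, gl x ∂area)) := by
  obtain ⟨K, hK⟩ := hg.bounded
  exact tendsto_integral_filter_of_dominated_convergence (fun _ => K)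
    (Eventually.of_forall fun u => (hg.continuous_slice u).aestronglyMeasurable)
    (Eventually.of_forall fun u => ae_of_all _ fun x => hK u x) (integrable_const K)
    (ae_of_all _ hg.tendsto)

end BoundedLimit

theorem hasTotalFlux_integral {g : ℝ → S2 → ℝ} {gp gm : S2 → ℝ} (hp : BoundedLimit atTop g gp)
    (hm : BoundedLimit atBot g gm) :
    HasTotalFlux (fun u => ∫ x, g u x ∂area) (∫ x, (gp x - gm x) ∂area) :=
  ⟨_, _, hp.tendsto_integral, hm.tendsto_integral,
    integral_sub (integrable_of_continuous hp.continuous_limit)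
      (integrable_of_continuous hm.continuous_limit)⟩

section Decay

variable {ε : ℝ} {g : ℝ → S2 → ℝ} {l : Filter ℝ}

theorem integrable_weight (hε : 0 < ε) : Integrable fun u : ℝ => (1 + |u|) ^ (-(1 + ε)) := by
  simpa only [Real.norm_eq_abs] using integrable_one_add_norm (E := ℝ) (r := 1 + ε) (by simpa)

theorem Decays.tendsto_zero (hε : 0 < ε) (hg : Decays ε g) (hl : Tendsto (fun u : ℝ => |u|) l atTop)
    (x : S2) : Tendsto (fun u => g u x) l (𝓝 0) := by
  obtain ⟨K, -, hK⟩ := hg.exists_abs_le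
  have hw := (tendsto_rpow_neg_atTop (by linarith : 0 < 1 + ε)).comp
    (tendsto_atTop_add_const_left l 1 hl)
  exact squeeze_zero_norm (fun u => hK u x) (by simpa using hw.const_mul K)

theorem Decays.boundedLimit_zero (hε : 0 < ε) (hg : Decays ε g)
    (hc : Continuous fun p : ℝ × S2 => g p.1 p.2) (hl : Tendsto (fun u : ℝ => |u|) l atTop) :
    BoundedLimit l g fun _ => 0 :=
  ⟨hg.bounded hε, hc, continuous_const, hg.tendsto_zero hε hl⟩

theorem Decays.exists_boundedLimit_primitive (hε : 0 < ε) (hg : Decays ε g)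
    (hc : Continuous fun p : ℝ × S2 => g p.1 p.2) (hl : l = atTop ∨ l = atBot) :
    ∃ gl, BoundedLimit l (fun u x => ∫ s in (0 : ℝ)..u, g s x) gl := by
  obtain ⟨K, hK0, hK⟩ := hg.exists_abs_le
  have hw : Integrable fun u : ℝ => K * (1 + |u|) ^ (-(1 + ε)) := (integrable_weight hε).const_mul K
  have hline (x : S2) : Continuous fun u => g u x := hc.comp (continuous_id.prodMk continuous_const)
  have hint (x : S2) : Integrable fun u => g u x :=
    hw.mono' (hline x).aestronglyMeasurable (ae_of_all _ fun u => hK u x)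
  have hcont (S : Set ℝ) : Continuous fun x => ∫ s in S, g s x :=
    continuous_of_dominated (fun x => (hline x).aestronglyMeasurable)
      (fun x => ae_of_all _ fun s => hK s x) hw.integrableOn
      (ae_of_all _ fun s => hc.comp (continuous_const.prodMk continuous_id))
  have hb : BoundedOnScri fun u x => ∫ s in (0 : ℝ)..u, g s x :=
    ⟨∫ u : ℝ, K * (1 + |u|) ^ (-(1 + ε)), fun u x =>
      calc ‖∫ s in (0 : ℝ)..u, g s x‖ ≤ ∫ s in Set.uIoc 0 u, ‖g s x‖ :=
            intervalIntegral.norm_integral_le_integral_norm_uIoc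
        _ ≤ ∫ s in Set.uIoc 0 u, K * (1 + |s|) ^ (-(1 + ε)) :=
            integral_mono (hint x).norm.integrableOn hw.integrableOn fun s => hK s x
        _ ≤ ∫ s, K * (1 + |s|) ^ (-(1 + ε)) :=
            setIntegral_le_integral hw (ae_of_all _ fun s => by positivity)⟩
  have hprim : Continuous fun p : ℝ × S2 => ∫ s in (0 : ℝ)..p.1, g s p.2 :=
    intervalIntegral.continuous_parametric_intervalIntegral_of_continuous
      (f := fun (p : ℝ × S2) s => g s p.2) (by fun_prop) continuous_fst
  rcases hl with rfl | rfl
  · exact ⟨fun x => ∫ s in Set.Ioi 0, g s x, hb, hprim, hcont _, fun x =>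
      intervalIntegral_tendsto_integral_Ioi 0 (hint x).integrableOn tendsto_id⟩
  · refine ⟨fun x => -∫ s in Set.Iic 0, g s x, hb, hprim, (hcont _).neg, fun x => ?_⟩
    simp only [intervalIntegral.integral_symm _ (0 : ℝ)]
    exact (intervalIntegral_tendsto_integral_Iic 0 (hint x).integrableOn tendsto_id).neg

theorem exists_boundedLimit_of_decays_deriv (hε : 0 < ε) (hg : SmoothOnScri g)
    (hd : Decays ε fun u x => deriv (fun s => g s x) u) (hl : l = atTop ∨ l = atBot) :
    ∃ gl, BoundedLimit l g gl := by
  obtain ⟨p, hp⟩ := hd.exists_boundedLimit_primitive hε hg.deriv.continuous hl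
  have h0 : Continuous (g 0) := ContMDiff.continuous (hg.slice 0)
  refine ⟨fun x => g 0 x + p x, ?_⟩
  simpa only [hg.intervalIntegral_deriv, add_sub_cancel] using
    (BoundedLimit.of_continuous h0).add hp

end Decay

/-! ### The supertranslated center of mass -/

namespace Data

section Supertranslated

variable (D : Data)

/-- `∇^A ∇^B C_{AB}`. -/
def divDivC (u : ℝ) (x : S2) : ℝ := ∑ j, pd j (fun y => divTensor (D.C u) y j) x

/-- The primitive in `u` of the flux density. -/
def fluxPrimitive (k : Fin 3) (u : ℝ) (x : S2) : ℝ := ∫ s in (0 : ℝ)..u, D.fluxDensity k s x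

/-- The shear stress after the supertranslation `f`, in terms of the retarded time before it. -/
def shiftedStress (f : S2 → ℝ) (k : Fin 3) (u : ℝ) (x : S2) : ℝ :=
  ∑ d, (D.C u x k d + shearShift f x k d) *
    (divTensor (D.C u) x d + ∑ i, D.news u x i d * pd i f x + divTensor (shearShift f) x d)

/-- A primitive of the flux density after the supertranslation `f`, in terms of the retarded time
before it. The flux density changes by a multiple of `N_{AB} N^{AB}`, of which
`-8 (m - ∇^A ∇^B C_{AB} / 4)` is a primitive by the mass loss formula. -/
def shiftedPrimitive (f : S2 → ℝ) (k : Fin 3) (u : ℝ) (x : S2) : ℝ :=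
  D.fluxPrimitive k u x + 2 * translationKernel k f x * (D.m u x - 1 / 4 * D.divDivC u x)
    - 1 / 2 * ∑ d, D.C u x k d * divTensor (shearShift f) x d

/-- The density whose integral over the cut `u = f` is, up to a constant, the center of mass after
the supertranslation `f`. -/
def fluxPotential (f : S2 → ℝ) (k : Fin 3) (u : ℝ) (x : S2) : ℝ :=
  D.shiftedPrimitive f k u x + 1 / 4 * D.shiftedStress f k u x

end Supertranslated

variable {D D' : Data} {f : S2 → ℝ}

section Vacuum

variable (hD : D.IsVacuum)
include hD

theorem IsVacuum.smooth_divDivC : SmoothOnScri D.divDivC :=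
  SmoothOnScri.sum fun j _ => (hD.smooth_divC j).pd j

theorem IsVacuum.hasDerivAt_divDivC (u : ℝ) (x : S2) :
    HasDerivAt (fun s => D.divDivC s x) (divForm (divTensor (D.news u)) x) u := by
  rw [divForm_eq fun l => ((hD.isSTF_news u).smoothOnS2_divTensor l).c1]
  refine HasDerivAt.fun_sum fun j _ => ?_
  simpa only [(hD.hasDerivAt_divC u _ j).deriv] using (hD.smooth_divC j).hasDerivAt_pd j u x

theorem IsVacuum.hasDerivAt_m_sub_divDivC (u : ℝ) (x : S2) :
    HasDerivAt (fun s => D.m s x - 1 / 4 * D.divDivC s x)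
      (-1 / 8 * pair (D.news u x) (D.news u x)) u := by
  refine ((hD.smooth_m.hasDerivAt u x).sub
    ((hD.hasDerivAt_divDivC u x).const_mul (1 / 4))).congr_deriv ?_
  rw [hD.evolution_m]
  ring

theorem IsVacuum.hasDerivAt_shiftedPrimitive (f : S2 → ℝ) (k : Fin 3) (u : ℝ) (x : S2) :
    HasDerivAt (fun s => D.shiftedPrimitive f k s x)
      (D.fluxDensity k u x
        - 1 / 4 * (translationKernel k f x * pair (D.news u x) (D.news u x))
        - 1 / 2 * ∑ d, D.news u x k d * divTensor (shearShift f) x d) u := by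
  have hflux : HasDerivAt (fun s => D.fluxPrimitive k s x) (D.fluxDensity k u x) u :=
    (((hD.smooth_fluxDensity k).continuous_line x).integral_hasStrictDerivAt 0 u).hasDerivAt
  have hshear : HasDerivAt (fun s => ∑ d, D.C s x k d * divTensor (shearShift f) x d)
      (∑ d, D.news u x k d * divTensor (shearShift f) x d) u :=
    HasDerivAt.fun_sum fun d _ => (hD.hasDerivAt_C u x k d).mul_const _
  refine ((hflux.add ((hD.hasDerivAt_m_sub_divDivC u x).const_mul
    (2 * translationKernel k f x))).sub (hshear.const_mul (1 / 2))).congr_deriv ?_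
  ring

theorem isSupertranslate_zero : D.IsSupertranslate (fun _ => 0) D := by
  have hpd (i : Fin 3) : pd i (fun _ => (0 : ℝ)) = fun _ => 0 := funext (pd_const i 0)
  exact {
    vacuum := hD
    m_eq := fun u x => by simp [grad, hess_eq (SmoothOnS2.const 0), pair, hpd]
    C_eq := fun u x i j => by
      simp [hess_eq (SmoothOnS2.const 0), lap_eq (SmoothOnS2.const 0), hpd] }

end Vacuum

namespace IsSupertranslate

variable (h : D.IsSupertranslate f D')
include h

theorem C_eq_add_shearShift (u : ℝ) (x : S2) (i j : Fin 3) :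
    D'.C u x i j = D.C (u + f x) x i j + shearShift f x i j := by
  rw [h.C_eq, shearShift]
  ring

theorem news_eq (u : ℝ) (x : S2) : D'.news u x = D.news (u + f x) x := by
  funext i j
  simp only [news, h.C_eq_add_shearShift]
  rw [deriv_add_const, deriv_comp_add_const (fun s => D.C s x i j)]

variable (hD : D.IsVacuum) (hf : SmoothOnS2 f)
include hD hf

theorem divTensor_C_eq (u : ℝ) (x : S2) (j : Fin 3) :
    divTensor (D'.C u) x j = divTensor (D.C (u + f x)) x j
      + ∑ i, D.news (u + f x) x i j * pd i f x + divTensor (shearShift f) x j := by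
  have hC : D'.C u = fun y i j => D.C (u + f y) y i j + shearShift f y i j := by
    funext y i j
    exact h.C_eq_add_shearShift u y i j
  rw [hC, (isSTF_shift hD.smooth_C hD.isSTF_C hf u).divTensor_add (isSTF_shearShift hf),
    divTensor_shift hD.smooth_C hD.isSTF_C hf]
  rfl

theorem shearStress_eq (k : Fin 3) (u : ℝ) (x : S2) :
    D'.shearStress k u x = D.shiftedStress f k (u + f x) x := by
  simp only [shearStress, shiftedStress, h.C_eq_add_shearShift, h.divTensor_C_eq hD hf]

theorem fluxDensity_eq (k : Fin 3) (u : ℝ) (x : S2) :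
    D'.fluxDensity k u x = D.fluxDensity k (u + f x) x
      - 1 / 4 * (translationKernel k f x * pair (D.news (u + f x) x) (D.news (u + f x) x))
      - 1 / 2 * ∑ d, D.news (u + f x) x k d * divTensor (shearShift f) x d := by
  have hnews : ∑ d, D.news (u + f x) x k d * ∑ i, D.news (u + f x) x i d * pd i f x
      = 1 / 2 * pair (D.news (u + f x) x) (D.news (u + f x) x) * pd k f x := by
    simp only [Finset.mul_sum]
    rw [Finset.sum_comm]
    simp only [← mul_assoc, ← Finset.sum_mul, (hD.isSTF_news _).sum_mul_self, σ_symm x k]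
    rw [← sum_σ_mul_pd hf.c1 x k, Finset.mul_sum]
    simp only [mul_assoc]
  simp only [fluxDensity, h.news_eq, h.divTensor_C_eq hD hf, mul_add, Finset.sum_add_distrib, hnews,
    translationKernel]
  ring

theorem centerOfMass_sub (k : Fin 3) (a b : ℝ) :
    D'.centerOfMass k b - D'.centerOfMass k a
      = ∫ x, (D.fluxPotential f k (b + f x) x - D.fluxPotential f k (a + f x) x) ∂area := by
  rw [h.vacuum.centerOfMass_sub k a b]
  refine integral_congr_ae (ae_of_all _ fun x => ?_)
  have hderiv (s : ℝ) : HasDerivAt (fun s => D.shiftedPrimitive f k (s + f x) x)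
      (D'.fluxDensity k s x) s := by
    rw [h.fluxDensity_eq hD hf]
    exact (hD.hasDerivAt_shiftedPrimitive f k (s + f x) x).comp_add_const s (f x)
  simp only [intervalIntegral.integral_eq_sub_of_hasDerivAt (fun s _ => hderiv s)
    (((h.vacuum.smooth_fluxDensity k).continuous_line x).intervalIntegrable a b),
    h.shearStress_eq hD hf, fluxPotential]
  ring

end IsSupertranslate

/-! ### Limits of the data at the ends of null infinity -/

section Decay

variable {ε : ℝ}

theorem NewsDecay.exists_decays (hD : D.IsVacuum) (hN : D.NewsDecay) : ∃ ε : ℝ, 0 < ε ∧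
    (∀ i j, Decays ε fun u x => D.news u x i j) ∧
    (∀ j, Decays ε fun u x => divTensor (D.news u) x j) ∧
    Decays ε fun u x => divForm (divTensor (D.news u)) x := by
  obtain ⟨ε, K, R, hε, h⟩ := hN
  have hpd (i j : Fin 3) : SmoothOnScri fun u x => pd i (fun y => D.news u y i j) x :=
    (hD.smooth_news i j).pd i
  refine ⟨ε, hε, fun i j => ?_, fun j => ?_, ?_⟩
  · exact .of_eventually hε (hD.smooth_news i j).continuous
      fun u hu hu0 x => (h u hu hu0 x i j).1
  · simp only [(hD.isSTF_news _).divTensor_eq]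
    exact .sum fun i _ => .of_eventually hε (hpd i j).continuous
      fun u hu hu0 x => (h u hu hu0 x i j).2.1 i
  · simp only [divForm_eq fun l => ((hD.isSTF_news _).smoothOnS2_divTensor l).c1,
      (hD.isSTF_news _).divTensor_eq, pd_sum _ _ fun i _ => ((hpd i _).slice _).c1]
    exact .sum fun j _ => .sum fun i _ => .of_eventually hε ((hpd i j).pd j).continuous
      fun u hu hu0 x => (h u hu hu0 x i j).2.2 j i

theorem decays_pair_news (hε : 0 < ε) (hN : ∀ i j, Decays ε fun u x => D.news u x i j) :
    Decays ε fun u x => pair (D.news u x) (D.news u x) :=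
  .sum fun i _ => .sum fun j _ => .bounded_mul ((hN i j).bounded hε) (hN i j)

theorem decays_fluxDensity (hε : 0 < ε) (hN : ∀ i j, Decays ε fun u x => D.news u x i j)
    (hC : ∀ j, BoundedOnScri fun u x => divTensor (D.C u) x j) (k : Fin 3) :
    Decays ε (D.fluxDensity k) := by
  have hX : BoundedOnScri fun _ x => 1 / 4 * x.1 k :=
    .of_continuous ((smoothOnS2_coord k).continuous.const_mul _)
  have hpair : Decays ε fun u x => ∑ i, ∑ j, u * D.news u x i j * D.news u x i j :=
    .sum fun i _ => .sum fun j _ => .bounded_mul ((hN i j).time_mul_bounded hε) (hN i j)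
  have hdiv : Decays ε fun u x => ∑ d, divTensor (D.C u) x d * D.news u x k d :=
    .sum fun d _ => .bounded_mul (hC d) (hN k d)
  convert (hpair.bounded_mul hX).add (hdiv.const_mul (-1 / 2)) using 3 with u x
  simp only [fluxDensity, pair, mul_assoc, ← Finset.mul_sum, mul_comm (divTensor _ _ _)]
  ring

end Decay

/-- Limits of the mass, of the shear and its divergences, and of the flux primitive along the
filter `l` of retarded times, in the presence of decaying news. -/
structure ScriLimit (D : Data) (l : Filter ℝ) where
  /-- The limit of the flux primitive. -/
  flux : Fin 3 → S2 → ℝ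
  /-- The limit of the shear. -/
  shear : Fin 3 → Fin 3 → S2 → ℝ
  /-- The limit of the divergence of the shear. -/
  shearDiv : Fin 3 → S2 → ℝ
  /-- The limit of the double divergence of the shear. -/
  shearDivDiv : S2 → ℝ
  /-- The limit of the mass aspect. -/
  mass : S2 → ℝ
  boundedLimit_flux : ∀ k, BoundedLimit l (D.fluxPrimitive k) (flux k)
  boundedLimit_shear : ∀ i j, BoundedLimit l (fun u x => D.C u x i j) (shear i j)
  boundedLimit_news : ∀ i j, BoundedLimit l (fun u x => D.news u x i j) fun _ => 0
  boundedLimit_shearDiv : ∀ j, BoundedLimit l (fun u x => divTensor (D.C u) x j) (shearDiv j)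
  boundedLimit_shearDivDiv : BoundedLimit l D.divDivC shearDivDiv
  boundedLimit_mass : BoundedLimit l D.m mass

theorem exists_scriLimit (hD : D.IsVacuum) (hN : D.NewsDecay) {l : Filter ℝ}
    (hl : l = atTop ∨ l = atBot) : Nonempty (ScriLimit D l) := by
  obtain ⟨ε, hε, hnews, hdiv, hdivdiv⟩ := hN.exists_decays hD
  have habs : Tendsto (fun u : ℝ => |u|) l atTop := by
    rcases hl with rfl | rfl
    exacts [tendsto_abs_atTop_atTop, tendsto_abs_atBot_atTop]
  have hlim {g : ℝ → S2 → ℝ} (hg : SmoothOnScri g)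
      (hd : Decays ε fun u x => deriv (fun s => g s x) u) : ∃ gl, BoundedLimit l g gl :=
    exists_boundedLimit_of_decays_deriv hε hg hd hl
  choose C hC using fun i j => hlim (hD.smooth_C i j) (hnews i j)
  choose divC hdivC using fun j => hlim (hD.smooth_divC j)
    (by simpa only [(hD.hasDerivAt_divC _ _ _).deriv] using hdiv j)
  obtain ⟨divDivC, hdivDivC⟩ := hlim hD.smooth_divDivC
    (by simpa only [(hD.hasDerivAt_divDivC _ _).deriv] using hdivdiv)
  obtain ⟨m, hm⟩ := hlim hD.smooth_m (by
    simp only [hD.evolution_m]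
    exact ((decays_pair_news hε hnews).const_mul _).add (hdivdiv.const_mul _))
  choose A hA using fun k =>
    (decays_fluxDensity hε hnews (fun j => (hdivC j).bounded) k).exists_boundedLimit_primitive hε
      (hD.smooth_fluxDensity k).continuous hl
  exact ⟨⟨A, C, divC, divDivC, m, hA, hC, fun i j =>
    (hnews i j).boundedLimit_zero hε (hD.smooth_news i j).continuous habs, hdivC, hdivDivC, hm⟩⟩

namespace ScriLimit

variable {l : Filter ℝ} (L : ScriLimit D l)

/-- The limit of the flux potential without supertranslation. -/
def com (k : Fin 3) (x : S2) : ℝ := L.flux k x + 1 / 4 * ∑ d, L.shear k d x * L.shearDiv d x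

/-- The limit of the flux potential. -/
def potential (f : S2 → ℝ) (k : Fin 3) (x : S2) : ℝ :=
  L.flux k x + 2 * translationKernel k f x * (L.mass x - 1 / 4 * L.shearDivDiv x)
    - 1 / 2 * ∑ d, L.shear k d x * divTensor (shearShift f) x d
    + 1 / 4 * ∑ d, (L.shear k d x + shearShift f x k d) *
      (L.shearDiv d x + divTensor (shearShift f) x d)

/-- The part of the limiting flux potential that is bilinear in the shear and the supertranslation;
it integrates to zero. -/
def shearPairing (f : S2 → ℝ) (k : Fin 3) (x : S2) : ℝ :=
  ∑ j, (shearShift f x k j * L.shearDiv j x - L.shear k j x * divTensor (shearShift f) x j)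
    - 2 * translationKernel k f x * L.shearDivDiv x

theorem potential_eq (k : Fin 3) (x : S2) :
    L.potential f k x = L.com k x + 2 * translationKernel k f x * L.mass x
      + 1 / 4 * L.shearPairing f k x
      + 1 / 4 * ∑ d, shearShift f x k d * divTensor (shearShift f) x d := by
  simp only [potential, com, shearPairing, mul_add, add_mul, Finset.sum_add_distrib,
    Finset.sum_sub_distrib]
  ring

theorem continuous_com (k : Fin 3) : Continuous (L.com k) :=
  ((L.boundedLimit_flux k).add ((BoundedLimit.sum fun d _ =>
    (L.boundedLimit_shear k d).mul (L.boundedLimit_shearDiv d)).const_mul _)).continuous_limit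

variable (hf : SmoothOnS2 f)
include hf

theorem boundedLimit_potential (k : Fin 3) :
    BoundedLimit l (D.fluxPotential f k) (L.potential f k) := by
  have hH (i j : Fin 3) := BoundedLimit.of_continuous (l := l)
    ((isSTF_shearShift hf).c1 i j).continuous
  have hdivH (j : Fin 3) := BoundedLimit.of_continuous (l := l)
    ((isSTF_shearShift hf).smoothOnS2_divTensor j).continuous
  have hkernel := BoundedLimit.of_continuous (l := l)
    ((smoothOnS2_translationKernel hf k).continuous.const_mul 2)
  have hnews (d : Fin 3) :
      BoundedLimit l (fun u x => ∑ i, D.news u x i d * pd i f x) fun _ => 0 := by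
    simpa only [zero_mul, Finset.sum_const_zero] using BoundedLimit.sum fun i _ =>
      (L.boundedLimit_news i d).mul (.of_continuous (hf.c1.continuous_pd i))
  have hstress := BoundedLimit.sum fun d (_ : d ∈ Finset.univ) =>
    ((L.boundedLimit_shear k d).add (hH k d)).mul
      (((L.boundedLimit_shearDiv d).add (hnews d)).add (hdivH d))
  have hshear := BoundedLimit.sum fun d (_ : d ∈ Finset.univ) =>
    (L.boundedLimit_shear k d).mul (hdivH d)
  have hmass := hkernel.mul
    (L.boundedLimit_mass.sub (L.boundedLimit_shearDivDiv.const_mul (1 / 4)))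
  simp only [add_zero] at hstress
  exact (((L.boundedLimit_flux k).add hmass).sub (hshear.const_mul (1 / 2))).add
    (hstress.const_mul (1 / 4))

theorem boundedLimit_shearPairing (k : Fin 3) :
    BoundedLimit l (fun u x => ∑ j, (shearShift f x k j * divTensor (D.C u) x j
      - D.C u x k j * divTensor (shearShift f) x j)
      - 2 * translationKernel k f x * D.divDivC u x) (L.shearPairing f k) :=
  (BoundedLimit.sum fun j _ => (BoundedLimit.mul
    (.of_continuous ((isSTF_shearShift hf).c1 k j).continuous) (L.boundedLimit_shearDiv j)).sub
    ((L.boundedLimit_shear k j).mul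
      (.of_continuous ((isSTF_shearShift hf).smoothOnS2_divTensor j).continuous))).sub
    (BoundedLimit.mul (.of_continuous ((smoothOnS2_translationKernel hf k).continuous.const_mul 2))
      L.boundedLimit_shearDivDiv)

theorem integral_shearPairing [l.NeBot] [l.IsCountablyGenerated] (hD : D.IsVacuum) (k : Fin 3) :
    ∫ x, L.shearPairing f k x ∂area = 0 := by
  have ht := (L.boundedLimit_shearPairing hf k).tendsto_integral
  simp only [divDivC, integral_shearShift_mul_divTensor hf (hD.isSTF_C _) k] at ht
  exact tendsto_nhds_unique ht tendsto_const_nhds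

end ScriLimit

section Flux

variable (hD : D.IsVacuum) (Lp : ScriLimit D atTop) (Lm : ScriLimit D atBot)
include hD

theorem integral_potential_sub (hf : SmoothOnS2 f) (k : Fin 3) :
    ∫ x, (Lp.potential f k x - Lm.potential f k x) ∂area
      = (∫ x, (Lp.com k x - Lm.com k x) ∂area)
        + ∫ x, 2 * translationKernel k f x * (Lp.mass x - Lm.mass x) ∂area := by
  have hcom : Integrable (fun x => Lp.com k x - Lm.com k x) area :=
    integrable_of_continuous ((Lp.continuous_com k).sub (Lm.continuous_com k))
  have hmass : Integrable (fun x => 2 * translationKernel k f x * (Lp.mass x - Lm.mass x)) area :=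
    integrable_of_continuous (((smoothOnS2_translationKernel hf k).continuous.const_mul 2).mul
      (Lp.boundedLimit_mass.continuous_limit.sub Lm.boundedLimit_mass.continuous_limit))
  have hp := integrable_of_continuous (Lp.boundedLimit_shearPairing hf k).continuous_limit
  have hm := integrable_of_continuous (Lm.boundedLimit_shearPairing hf k).continuous_limit
  calc ∫ x, (Lp.potential f k x - Lm.potential f k x) ∂area
      = ∫ x, (Lp.com k x - Lm.com k x
          + 2 * translationKernel k f x * (Lp.mass x - Lm.mass x)
          + 1 / 4 * (Lp.shearPairing f k x - Lm.shearPairing f k x)) ∂area := by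
        simp only [ScriLimit.potential_eq]
        exact integral_congr_ae (ae_of_all _ fun x => by ring)
    _ = _ := by
        rw [integral_add, integral_add hcom hmass, integral_const_mul, integral_sub hp hm,
          Lp.integral_shearPairing hf hD, Lm.integral_shearPairing hf hD, sub_zero, mul_zero,
          add_zero]
        exacts [hcom.add hmass, (hp.sub hm).const_mul _]

theorem IsSupertranslate.hasTotalFlux_centerOfMass (h : D.IsSupertranslate f D')
    (hf : SmoothOnS2 f) (k : Fin 3) :
    HasTotalFlux (D'.centerOfMass k) ((∫ x, (Lp.com k x - Lm.com k x) ∂area)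
      + ∫ x, 2 * translationKernel k f x * (Lp.mass x - Lm.mass x) ∂area) := by
  have hp := (Lp.boundedLimit_potential hf k).shift
    (fun c => tendsto_atTop_add_const_right _ c tendsto_id) hf.continuous
  have hm := (Lm.boundedLimit_potential hf k).shift
    (fun c => tendsto_atBot_add_const_right _ c tendsto_id) hf.continuous
  have h0 := hp.continuous_slice 0
  obtain ⟨a, b, ha, hb, hab⟩ := hasTotalFlux_integral (hp.sub (.of_continuous h0))
    (hm.sub (.of_continuous h0))
  simp only [sub_sub_sub_cancel_right, integral_potential_sub hD Lp Lm hf,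
    ← h.centerOfMass_sub hD hf k 0] at ha hb hab
  refine ⟨a + D'.centerOfMass k 0, b + D'.centerOfMass k 0, ?_, ?_, ?_⟩
  · simpa only [sub_add_cancel] using ha.add_const (D'.centerOfMass k 0)
  · simpa only [sub_add_cancel] using hb.add_const (D'.centerOfMass k 0)
  · rw [hab, add_sub_add_right_eq_sub]

theorem hasTotalFlux_centerOfMass (k : Fin 3) :
    HasTotalFlux (D.centerOfMass k) (∫ x, (Lp.com k x - Lm.com k x) ∂area) := by
  simpa [translationKernel, pd_const] using
    (isSupertranslate_zero hD).hasTotalFlux_centerOfMass hD Lp Lm (SmoothOnS2.const 0) k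

end Flux

end Data

/-! ### Existence of supertranslated data -/

section Primitive

-- The integral is the value at `0` of a convolution with the indicator function of the unit
-- interval; cutting `F` off outside a larger interval makes the smoothness of convolutions with
-- compactly supported functions applicable.
theorem contDiffOn_integral_unitInterval {P E : Type*} [NormedAddCommGroup P] [NormedSpace ℝ P]
    [NormedAddCommGroup E] [NormedSpace ℝ E] {n : ℕ∞} {s : Set P} (hs : IsOpen s)
    {F : P × ℝ → E} (hF : ContDiffOn ℝ n F (s ×ˢ Set.univ)) :
    ContDiffOn ℝ n (fun p => ∫ t in (0 : ℝ)..1, F (p, t)) s := by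
  let χ : ContDiffBump (0 : ℝ) := ⟨1, 2, one_pos, one_lt_two⟩
  let w : ℝ → ℝ := (Set.Ioc 0 1).indicator fun _ => 1
  let G : P → ℝ → E := fun p z => χ z • F (p, -z)
  have hw : LocallyIntegrable w :=
    ((integrable_indicator_iff measurableSet_Ioc).2
      (integrableOn_const (by simp))).locallyIntegrable
  have hG : ContDiffOn ℝ n ↿G (s ×ˢ Set.univ) := by
    have hreflect : ContDiff ℝ n fun q : P × ℝ => (q.1, -q.2) := by fun_prop
    exact (χ.contDiff.comp contDiff_snd).contDiffOn.smul
      (hF.comp hreflect.contDiffOn fun q hq => ⟨hq.1, Set.mem_univ _⟩)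
  have hsupport (p : P) (z : ℝ) (_ : p ∈ s) (hz : z ∉ Metric.closedBall (0 : ℝ) 2) :
      G p z = 0 := by
    have hχ : χ z = 0 := χ.zero_of_le_dist (le_of_not_ge hz)
    simp only [G, hχ, zero_smul]
  refine (contDiffOn_convolution_right_with_param_comp (μ := volume)
    (ContinuousLinearMap.lsmul ℝ ℝ) contDiffOn_const hs (isCompact_closedBall (0 : ℝ) 2) hsupport
    hw hG (v := fun _ => 0)).congr fun p _ => ?_
  rw [MeasureTheory.convolution, intervalIntegral.integral_of_le zero_le_one,
    ← integral_indicator measurableSet_Ioc]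
  refine integral_congr_ae (ae_of_all _ fun t => ?_)
  by_cases ht : t ∈ Set.Ioc (0 : ℝ) 1
  · have hχ : χ (-t) = 1 := χ.one_of_mem_closedBall <| by
      rw [mem_closedBall_zero_iff, norm_neg, Real.norm_eq_abs, abs_of_pos ht.1]
      exact ht.2
    simp only [ContinuousLinearMap.lsmul_apply, w, G, hχ, Set.indicator_of_mem ht, zero_sub,
      neg_neg, one_smul]
  · simp only [w, Set.indicator_of_notMem ht, map_zero, zero_apply]

theorem SmoothOnScri.primitive {g : ℝ → S2 → ℝ} (hg : SmoothOnScri g) :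
    SmoothOnScri fun u x => ∫ s in (0 : ℝ)..u, g s x := by
  have hext : ContDiffOn ℝ ∞ (scriExt g) punctured := fun p hp =>
    (contDiffAt_scriExt hg p.1 hp).contDiffWithinAt
  have hscale : ContDiff ℝ ∞ fun q : (ℝ × E3) × ℝ => (q.1.1 * q.2, q.1.2) := by fun_prop
  have hF : ContDiffOn ℝ ∞ (fun q : (ℝ × E3) × ℝ => scriExt g (q.1.1 * q.2, q.1.2))
      ((punctured : Set (ℝ × E3)) ×ˢ Set.univ) :=
    hext.comp hscale.contDiffOn fun q hq => hq.1
  have hsubst (u : ℝ) (x : S2) : u * ∫ t in (0 : ℝ)..1, g (u * t) x = ∫ s in (0 : ℝ)..u, g s x := by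
    simpa only [smul_eq_mul, mul_zero, mul_one] using
      intervalIntegral.smul_integral_comp_mul_left (fun s => g s x) u (a := 0) (b := 1)
  have h := SmoothOnScri.of_contDiffOn
    (contDiffOn_fst.mul (contDiffOn_integral_unitInterval punctured.isOpen hF))
  simpa only [scriExt, radialExt_coe, hsubst] using h

end Primitive

section Shift

variable {w : ℝ → S2 → Fin 3 → ℝ} {T : ℝ → S2 → Fin 3 → Fin 3 → ℝ} {f : S2 → ℝ}

theorem divForm_shift (hw : ∀ j, SmoothOnScri fun u x => w u x j) (hf : SmoothOnS2 f) (u : ℝ)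
    (x : S2) : divForm (fun y => w (u + f y) y) x
      = divForm (w (u + f x)) x + ∑ j, deriv (fun s => w s x j) (u + f x) * pd j f x := by
  rw [divForm_eq fun j => (((hw j).shift hf).slice u).c1, divForm_eq fun j => ((hw j).slice _).c1,
    ← Finset.sum_add_distrib]
  exact Finset.sum_congr rfl fun j _ => (hw j).pd_shift hf.c1 j u x

theorem divForm_add {v w : S2 → Fin 3 → ℝ} (hv : ∀ j, C1 fun x => v x j)
    (hw : ∀ j, C1 fun x => w x j) (x : S2) :
    divForm (fun y j => v y j + w y j) x = divForm v x + divForm w x := by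
  have hvw (j : Fin 3) : C1 fun x => v x j + w x j := (hv j).add (hw j)
  rw [divForm_eq hvw, divForm_eq hv, divForm_eq hw, ← Finset.sum_add_distrib]
  exact Finset.sum_congr rfl fun j _ => pd_add j (hv j) (hw j) x

theorem divForm_divTensor_shift (hs : ∀ i j, SmoothOnScri fun u x => T u x i j)
    (hT : ∀ u, IsSTF (T u)) (hf : SmoothOnS2 f) (u : ℝ) (x : S2) :
    divForm (divTensor fun y => T (u + f y) y) x
      = divForm (divTensor (T (u + f x))) x
        + 2 * ∑ j, divTensor (timeDeriv T (u + f x)) x j * pd j f x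
        + ∑ i, ∑ j, timeDeriv (timeDeriv T) (u + f x) x i j * pd i f x * pd j f x
        + pair (timeDeriv T (u + f x) x) (hess f x) := by
  have hs' := smooth_timeDeriv hs
  have hT' := isSTF_timeDeriv hs hT
  have hdiv := SmoothOnScri.divTensor hs
  have hgrad (j : Fin 3) : SmoothOnScri fun u x => ∑ i, timeDeriv T u x i j * pd i f x :=
    SmoothOnScri.sum fun i _ => (hs' i j).mul (hf.pd i).smoothOnScri
  have hshift : (divTensor fun y => T (u + f y) y) = fun y j =>
      divTensor (T (u + f y)) y j + ∑ i, timeDeriv T (u + f y) y i j * pd i f y := by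
    funext y j
    exact divTensor_shift hs hT hf u y j
  have hdivForm : divForm (fun y j => divTensor (T (u + f x)) y j
      + ∑ i, timeDeriv T (u + f x) y i j * pd i f y) x
      = divForm (divTensor (T (u + f x))) x
        + (∑ j, divTensor (timeDeriv T (u + f x)) x j * pd j f x
          + pair (timeDeriv T (u + f x) x) (hess f x)) := by
    rw [← (hT' _).divForm_sum_mul_pd hf]
    exact divForm_add (fun j => ((hdiv j).slice (u + f x)).c1)
      (fun j => ((hgrad j).slice (u + f x)).c1) x
  have hderiv (j : Fin 3) : deriv (fun s => divTensor (T s) x j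
      + ∑ i, timeDeriv T s x i j * pd i f x) (u + f x)
      = divTensor (timeDeriv T (u + f x)) x j
        + ∑ i, timeDeriv (timeDeriv T) (u + f x) x i j * pd i f x :=
    ((hasDerivAt_divTensor hs hT _ x j).add (HasDerivAt.fun_sum fun i _ =>
      (hasDerivAt_timeDeriv hs' _ x i j).mul_const _)).deriv
  rw [hshift, divForm_shift (fun j => (hdiv j).add (hgrad j)) hf, hdivForm]
  simp only [hderiv, add_mul, Finset.sum_mul, Finset.sum_add_distrib]
  rw [Finset.sum_comm (f := fun j i => timeDeriv (timeDeriv T) (u + f x) x i j * _ * _)]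
  ring

end Shift

namespace Data

/-- The right-hand side of the evolution equation of the angular momentum aspect. -/
def evolutionNA (D : Data) (u : ℝ) (x : S2) (i : Fin 3) : ℝ :=
  pd i (D.m u) x
    - 1 / 4 * divTensor (curl (divTensor (D.C u))) x i
    + 1 / 4 * pd i (fun y => pair (D.C u y) (D.news u y)) x
    - 1 / 4 * divTensor (contract (D.C u) (D.news u)) x i
    + 1 / 2 * ∑ b, D.C u x i b * divTensor (D.news u) x b

section EvolutionNA

variable {D : Data} (hm : SmoothOnScri D.m) (hC : ∀ i j, SmoothOnScri fun u x => D.C u x i j)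
include hm hC

theorem smooth_evolutionNA (i : Fin 3) : SmoothOnScri fun u x => D.evolutionNA u x i := by
  have hN := smooth_timeDeriv hC
  have hdiv (i j : Fin 3) := SmoothOnScri.covForm (SmoothOnScri.divTensor hC) i j
  have hcurl := SmoothOnScri.divTensor (T := fun u => curl (divTensor (D.C u)))
    (fun i j => (hdiv i j).sub (hdiv j i)) i
  have hcontract := SmoothOnScri.divTensor (T := fun u => contract (D.C u) (D.news u))
    (fun i j => SmoothOnScri.sum fun d _ => (hC i d).mul (hN d j)) i
  have hstress := SmoothOnScri.sum (s := Finset.univ) fun b _ =>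
    (hC i b).mul (SmoothOnScri.divTensor hN b)
  exact ((((hm.pd i).sub ((SmoothOnScri.const _).mul hcurl)).add
    ((SmoothOnScri.const _).mul ((SmoothOnScri.pair hC hN).pd i))).sub
    ((SmoothOnScri.const _).mul hcontract)).add ((SmoothOnScri.const _).mul hstress)

theorem evolutionNA_tangential (ht : ∀ u x j, ∑ i, x.1 i * D.C u x i j = 0) (u : ℝ) (x : S2) :
    ∑ i, x.1 i * D.evolutionNA u x i = 0 := by
  have hpair : SmoothOnS2 fun y => pair (D.C u y) (D.news u y) :=
    (SmoothOnScri.pair hC (smooth_timeDeriv hC)).slice u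
  have hstress : ∑ i, x.1 i * ∑ b, D.C u x i b * divTensor (D.news u) x b = 0 := by
    simp only [Finset.mul_sum]
    rw [Finset.sum_comm]
    simp only [← mul_assoc, ← Finset.sum_mul, ht, zero_mul, Finset.sum_const_zero]
  simp only [evolutionNA, mul_add, mul_sub, mul_left_comm (x.1 _) (_ / _), Finset.sum_add_distrib,
    Finset.sum_sub_distrib, ← Finset.mul_sum, sum_coord_mul_pd (hm.slice u).c1,
    sum_coord_mul_pd hpair.c1, divTensor_tangential, hstress]
  ring

end EvolutionNA

/-- The mass aspect after the supertranslation `f`. -/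
def shiftedMass (D : Data) (f : S2 → ℝ) (u : ℝ) (x : S2) : ℝ :=
  D.m (u + f x) x
    + 1 / 2 * ∑ d, divTensor (D.news (u + f x)) x d * pd d f x
    + 1 / 4 * ∑ b, ∑ d, timeDeriv D.news (u + f x) x b d * pd b f x * pd d f x
    + 1 / 4 * pair (D.news (u + f x) x) (hess f x)

/-- The shear after the supertranslation `f`. -/
def shiftedShear (D : Data) (f : S2 → ℝ) (u : ℝ) (x : S2) (i j : Fin 3) : ℝ :=
  D.C (u + f x) x i j + shearShift f x i j

/-- The data after the supertranslation `f` whose angular momentum aspect vanishes at `u = 0`. -/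
def supertranslate (D : Data) (f : S2 → ℝ) : Data where
  m := D.shiftedMass f
  NA u x i := ∫ s in (0 : ℝ)..u, evolutionNA ⟨D.shiftedMass f, 0, D.shiftedShear f⟩ s x i
  C := D.shiftedShear f

section Supertranslate

variable {D : Data} {f : S2 → ℝ}

theorem news_supertranslate (D : Data) (f : S2 → ℝ) (u : ℝ) :
    (D.supertranslate f).news u = fun x => D.news (u + f x) x := by
  funext x i j
  simp only [news, supertranslate, shiftedShear]
  rw [deriv_add_const, deriv_comp_add_const (fun s => D.C s x i j)]

variable (hD : D.IsVacuum)
include hD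

theorem hasDerivAt_shiftedMass (f : S2 → ℝ) (u : ℝ) (x : S2) :
    HasDerivAt (fun s => D.shiftedMass f s x) (deriv (fun s => D.m s x) (u + f x)
      + 1 / 2 * ∑ d, divTensor (timeDeriv D.news (u + f x)) x d * pd d f x
      + 1 / 4 * ∑ b, ∑ d, timeDeriv (timeDeriv D.news) (u + f x) x b d * pd b f x * pd d f x
      + 1 / 4 * pair (timeDeriv D.news (u + f x) x) (hess f x)) u := by
  have hs := hD.smooth_news
  have hmass := (hD.smooth_m.hasDerivAt (u + f x) x).comp_add_const u (f x)
  have hdiv (d : Fin 3) :=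
    (hasDerivAt_divTensor hs hD.isSTF_news (u + f x) x d).comp_add_const u (f x)
  have hnews (i j : Fin 3) := (hasDerivAt_timeDeriv hs (u + f x) x i j).comp_add_const u (f x)
  have hnews' (i j : Fin 3) :=
    (hasDerivAt_timeDeriv (smooth_timeDeriv hs) (u + f x) x i j).comp_add_const u (f x)
  exact ((hmass.add ((HasDerivAt.fun_sum fun d _ => (hdiv d).mul_const _).const_mul _)).add
    ((HasDerivAt.fun_sum fun b _ => HasDerivAt.fun_sum fun d _ =>
      ((hnews' b d).mul_const _).mul_const _).const_mul _)).add
    ((HasDerivAt.fun_sum fun b _ => HasDerivAt.fun_sum fun d _ =>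
      (hnews b d).mul_const _).const_mul _)

variable (hf : SmoothOnS2 f)
include hf

theorem smooth_shiftedMass : SmoothOnScri (D.shiftedMass f) := by
  have hs := hD.smooth_news
  have hp (d : Fin 3) := (hf.pd d).smoothOnScri
  have hdiv := SmoothOnScri.sum (s := Finset.univ) fun d _ =>
    ((SmoothOnScri.divTensor hs d).shift hf).mul (hp d)
  have hgrad := SmoothOnScri.sum (s := Finset.univ) fun b _ =>
    SmoothOnScri.sum (s := Finset.univ) fun d _ =>
      (((smooth_timeDeriv hs b d).shift hf).mul (hp b)).mul (hp d)
  have hhess := SmoothOnScri.pair (fun i j => (hs i j).shift hf)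
    fun i j => (smoothOnS2_hess hf i j).smoothOnScri
  exact (((hD.smooth_m.shift hf).add ((SmoothOnScri.const _).mul hdiv)).add
    ((SmoothOnScri.const _).mul hgrad)).add ((SmoothOnScri.const _).mul hhess)

theorem smooth_shiftedShear (i j : Fin 3) : SmoothOnScri fun u x => D.shiftedShear f u x i j :=
  ((hD.smooth_C i j).shift hf).add ((isSTF_shearShift hf).smooth i j).smoothOnScri

theorem isSTF_shiftedShear (u : ℝ) : IsSTF (D.shiftedShear f u) :=
  (isSTF_shift hD.smooth_C hD.isSTF_C hf u).add (isSTF_shearShift hf)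

theorem isVacuum_supertranslate : (D.supertranslate f).IsVacuum := by
  have hm := smooth_shiftedMass hD hf
  have hC := smooth_shiftedShear hD hf
  have hSTF := isSTF_shiftedShear hD hf
  let S : Data := ⟨D.shiftedMass f, 0, D.shiftedShear f⟩
  have hNA : ∀ i, SmoothOnScri fun u x => S.evolutionNA u x i := smooth_evolutionNA hm hC
  have ht : ∀ u x, ∑ i, x.1 i * S.evolutionNA u x i = 0 :=
    evolutionNA_tangential hm hC fun u => (hSTF u).tangential
  refine
    { smooth_m := hm
      smooth_NA := fun i => (hNA i).primitive
      smooth_C := hC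
      tangential_NA := fun u x => ?_
      tangential_C := fun u => (hSTF u).tangential
      symm_C := fun u => (hSTF u).symm
      traceless_C := fun u => (hSTF u).traceless
      evolution_m := fun u x => ?_
      evolution_NA := fun u x i => ((hNA i).continuous_line x).deriv_integral _ 0 u }
  · simp only [supertranslate, ← intervalIntegral.integral_const_mul]
    rw [← intervalIntegral.integral_finsetSum fun i _ =>
      (((hNA i).continuous_line x).const_mul _).intervalIntegrable _ _]
    simp only [S, ht, intervalIntegral.integral_zero]
  · refine (hasDerivAt_shiftedMass hD f u x).deriv.trans ?_
    rw [news_supertranslate, divForm_divTensor_shift hD.smooth_news hD.isSTF_news hf,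
      hD.evolution_m]
    ring

theorem isSupertranslate_supertranslate : D.IsSupertranslate f (D.supertranslate f) where
  vacuum := isVacuum_supertranslate hD hf
  m_eq _ _ := rfl
  C_eq u x i j := by
    simp only [supertranslate, shiftedShear, shearShift]
    ring

end Supertranslate

end Data

/-! ### Low and high modes -/

/-- The functions on the sphere in the modes `ℓ ≤ 1`. -/
def lowModes (a : ℝ) (b : Fin 3 → ℝ) (x : S2) : ℝ := a + ∑ i, b i * X i x

theorem smoothOnS2_lowModes (a : ℝ) (b : Fin 3 → ℝ) : SmoothOnS2 (lowModes a b) :=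
  (SmoothOnS2.const a).add <| contMDiff_finsetSum fun i _ =>
    (SmoothOnS2.const (b i)).mul (smoothOnS2_coord i)

theorem integral_coord (k : Fin 3) : ∫ x : S2, x.1 k ∂area = 0 := by
  have h := integral_pd (SmoothOnS2.const 1).c1 k
  simp only [pd_const, integral_zero, mul_one] at h
  linarith

theorem integral_coord_mul_coord (i j : Fin 3) :
    ∫ x : S2, x.1 i * x.1 j ∂area = if i = j then area.real Set.univ / 3 else 0 := by
  have h := integral_pd (smoothOnS2_coord j).c1 i
  simp only [pd_coord, σ] at h
  rw [integral_sub (integrable_const _) (integrable_of_continuous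
    ((smoothOnS2_coord j).c1.coord_mul i).continuous), integral_const, smul_eq_mul] at h
  split_ifs at h ⊢ <;> linarith

theorem integral_lowModes (a : ℝ) (b : Fin 3 → ℝ) :
    ∫ x, lowModes a b x ∂area = area.real Set.univ * a := by
  have hint (i : Fin 3) : Integrable (fun x => b i * X i x) area :=
    (integrable_of_continuous (smoothOnS2_coord i).continuous).const_mul _
  simp only [lowModes]
  rw [integral_add (integrable_const _) (integrable_finsetSum _ fun i _ => hint i),
    integral_finsetSum _ fun i _ => hint i]
  simp only [integral_const, smul_eq_mul, integral_const_mul, X, integral_coord, mul_zero,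
    Finset.sum_const_zero, add_zero]

theorem integral_lowModes_mul_coord (a : ℝ) (b : Fin 3 → ℝ) (k : Fin 3) :
    ∫ x, lowModes a b x * X k x ∂area = area.real Set.univ / 3 * b k := by
  have hk : Integrable (fun x => a * X k x) area :=
    (integrable_of_continuous (smoothOnS2_coord k).continuous).const_mul _
  have hik (i : Fin 3) : Integrable (fun x => b i * (X i x * X k x)) area :=
    (integrable_of_continuous ((smoothOnS2_coord k).c1.coord_mul i).continuous).const_mul _
  simp only [lowModes, add_mul, Finset.sum_mul, mul_assoc]
  rw [integral_add hk (integrable_finsetSum _ fun i _ => hik i),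
    integral_finsetSum _ fun i _ => hik i]
  simp only [integral_const_mul, X, integral_coord, integral_coord_mul_coord, mul_ite, mul_zero,
    Finset.sum_ite_eq', Finset.mem_univ, if_true, zero_add, mul_comm (b k)]

theorem exists_eq_lowModes_add {q : S2 → ℝ} (hq : SmoothOnS2 q) :
    ∃ h, SmoothOnS2 h ∧ SupportedInHigherModes h ∧ q = fun x =>
      lowModes (⨍ y, q y ∂area) (fun i => 3 * ⨍ y, q y * X i y ∂area) x + h x := by
  set L := lowModes (⨍ y, q y ∂area) fun i => 3 * ⨍ y, q y * X i y ∂area with hL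
  have hLs : SmoothOnS2 L := smoothOnS2_lowModes _ _
  refine ⟨fun x => q x - L x, hq.sub hLs, ⟨?_, fun k => ?_⟩, by simp only [add_sub_cancel]⟩
  · rw [integral_sub (integrable_of_continuous hq.continuous)
      (integrable_of_continuous hLs.continuous), hL, integral_lowModes, ← smul_eq_mul,
      measure_smul_average, sub_self]
  · have hmul {g : S2 → ℝ} (hg : SmoothOnS2 g) : Integrable (fun x => g x * X k x) area :=
      integrable_of_continuous (hg.continuous.mul (smoothOnS2_coord k).continuous)
    simp only [sub_mul]
    rw [integral_sub (hmul hq) (hmul hLs), hL, integral_lowModes_mul_coord,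
      div_mul_eq_mul_div, mul_left_comm, mul_div_cancel_left₀ _ three_ne_zero, ← smul_eq_mul,
      measure_smul_average, sub_self]

section TranslationKernel

variable {f δ : S2 → ℝ}

theorem sum_grad_X_mul_grad (hf : C1 f) (k : Fin 3) (x : S2) :
    ∑ i, grad (X k) x i * grad f x i = pd k f x :=
  sum_grad_X_mul x k (sum_coord_mul_pd hf x)

theorem two_mul_translationKernel (hf : C1 f) (k : Fin 3) (x : S2) :
    2 * translationKernel k f x = 2 * X k x * f x + 2 * ∑ i, grad (X k) x i * grad f x i := by
  rw [sum_grad_X_mul_grad hf, translationKernel, X]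
  ring

theorem integral_translationKernel_mul (hf : C1 f) (hδ : C1 δ) (k : Fin 3) :
    ∫ x, 2 * translationKernel k f x * δ x ∂area
      = ∫ x, (6 * X k x * δ x - 2 * ∑ i, grad (X k) x i * grad δ x i) * f x ∂area := by
  have hfδ : C1 fun x => f x * δ x := hf.mul hδ
  have hdiff (x : S2) : 2 * translationKernel k f x * δ x
      - (6 * X k x * δ x - 2 * ∑ i, grad (X k) x i * grad δ x i) * f x
      = 2 * (pd k (fun y => f y * δ y) x - 2 * (x.1 k * (f x * δ x))) := by
    rw [sum_grad_X_mul_grad hδ, pd_mul k hf hδ, translationKernel, X]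
    ring
  have hleft : Continuous fun x => 2 * translationKernel k f x * δ x :=
    (((hf.coord_mul k).continuous.add (hf.continuous_pd k)).const_mul 2).mul hδ.continuous
  have hright : Continuous fun x =>
      (6 * X k x * δ x - 2 * ∑ i, grad (X k) x i * grad δ x i) * f x := by
    simp only [sum_grad_X_mul_grad hδ, X, mul_assoc]
    exact (((hδ.coord_mul k).continuous.const_mul 6).sub
      ((hδ.continuous_pd k).const_mul 2)).mul hf.continuous
  rw [← sub_eq_zero, ← integral_sub (integrable_of_continuous hleft)
    (integrable_of_continuous hright)]
  simp only [hdiff, integral_const_mul, integral_pd_sub hfδ, mul_zero]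

theorem integral_translationKernel (hf : C1 f) (k : Fin 3) :
    ∫ x, translationKernel k f x ∂area = 3 * ∫ x, X k x * f x ∂area := by
  simp only [translationKernel, X]
  rw [integral_add (integrable_of_continuous (hf.coord_mul k).continuous)
    (integrable_of_continuous (hf.continuous_pd k)), integral_pd hf]
  ring

theorem translationKernel_lowModes_add (hf : C1 f) (a : ℝ) (b : Fin 3 → ℝ) (k : Fin 3) (x : S2) :
    translationKernel k (fun y => lowModes a b y + f y) x
      = a * X k x + b k + translationKernel k f x := by
  have hX (i : Fin 3) : C1 (X i) := (smoothOnS2_coord i).c1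
  have hb (i : Fin 3) : C1 fun y => b i * X i y := (hX i).const_mul (b i)
  have hpd : pd k (lowModes a b) x = b k - x.1 k * ∑ i, x.1 i * b i := by
    rw [← sum_σ_mul, show lowModes a b = fun y => a + ∑ i, b i * X i y from rfl,
      pd_add k (SmoothOnS2.const a).c1 (contMDiff_finsetSum fun i _ => hb i), pd_const, zero_add,
      pd_sum _ k fun i _ => hb i]
    refine Finset.sum_congr rfl fun i _ => ?_
    rw [pd_const_mul k _ (hX i), show X i = fun y => y.1 i from rfl, pd_coord, σ_symm, mul_comm]
  rw [translationKernel, translationKernel, pd_add k (smoothOnS2_lowModes a b).c1 hf, hpd, lowModes]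
  simp only [X, mul_comm (b _)]
  ring

theorem integral_translationKernel_lowModes_add_mul (hf : SmoothOnS2 f) (hδ : Continuous δ) (a : ℝ)
    (b : Fin 3 → ℝ) (k : Fin 3) :
    ∫ x, 2 * translationKernel k (fun y => lowModes a b y + f y) x * δ x ∂area
      = a * (∫ x, 2 * δ x * X k x ∂area) + b k * (∫ x, 2 * δ x ∂area)
        + ∫ x, 2 * translationKernel k f x * δ x ∂area := by
  have h2δ : Continuous fun x => 2 * δ x := hδ.const_mul 2
  have hmom : Integrable (fun x => a * (2 * δ x * X k x)) area :=
    (integrable_of_continuous (h2δ.mul (smoothOnS2_coord k).continuous)).const_mul a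
  have hen : Integrable (fun x => b k * (2 * δ x)) area :=
    (integrable_of_continuous h2δ).const_mul (b k)
  have hmomen : Integrable (fun x => a * (2 * δ x * X k x) + b k * (2 * δ x)) area := hmom.add hen
  have hker : Integrable (fun x => 2 * translationKernel k f x * δ x) area :=
    integrable_of_continuous (((smoothOnS2_translationKernel hf k).continuous.const_mul 2).mul hδ)
  rw [← integral_const_mul, ← integral_const_mul, ← integral_add hmom hen,
    ← integral_add hmomen hker]
  refine integral_congr_ae (ae_of_all _ fun x => ?_)
  simp only [translationKernel_lowModes_add hf.c1]
  ring

theorem sum_translationKernel_coord_mul (hf : C1 f) (x : S2) :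
    ∑ k, translationKernel k (fun y => y.1 k * f y) x = 3 * f x := by
  have hk (k : Fin 3) : translationKernel k (fun y => y.1 k * f y) x
      = x.1 k * x.1 k * f x + σ x k k * f x + x.1 k * pd k f x := by
    rw [translationKernel, pd_coord_mul hf]
    ring
  simp only [hk, Finset.sum_add_distrib, ← Finset.sum_mul, S2.sum_coord_mul_self, sum_σ_self,
    sum_coord_mul_pd hf]
  ring

end TranslationKernel

section Orthogonality

variable {δ : S2 → ℝ} (hδ : Continuous δ)
  (horth : ∀ h, SmoothOnS2 h → SupportedInHigherModes h →
    ∀ k, ∫ x, 2 * translationKernel k h x * δ x ∂area = 0)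
include hδ horth

theorem integral_translationKernel_mul_of_orthogonal {q : S2 → ℝ} (hq : SmoothOnS2 q)
    (k : Fin 3) : ∫ x, 2 * translationKernel k q x * δ x ∂area
      = (⨍ y, q y ∂area) * (∫ x, 2 * δ x * X k x ∂area)
        + 3 * (⨍ y, q y * X k y ∂area) * ∫ x, 2 * δ x ∂area := by
  obtain ⟨h, hs, hh, hqh⟩ := exists_eq_lowModes_add hq
  conv_lhs => rw [hqh]
  rw [integral_translationKernel_lowModes_add_mul hs hδ, horth h hs hh k, add_zero]

theorem three_mul_integral_mul_of_orthogonal {g : S2 → ℝ} (hg : SmoothOnS2 g) :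
    3 * ∫ x, 2 * δ x * g x ∂area
      = ∑ k, (⨍ y, y.1 k * g y ∂area) * (∫ x, 2 * δ x * X k x ∂area)
        + 3 * (⨍ y, g y ∂area) * ∫ x, 2 * δ x ∂area := by
  have hs (k : Fin 3) : SmoothOnS2 fun y => y.1 k * g y := (smoothOnS2_coord k).mul hg
  have hker (k : Fin 3) :
      Integrable (fun x => 2 * translationKernel k (fun y => y.1 k * g y) x * δ x) area :=
    integrable_of_continuous
      (((smoothOnS2_translationKernel (hs k) k).continuous.const_mul 2).mul hδ)
  have hint (k : Fin 3) : Integrable (fun y => y.1 k * g y * X k y) area :=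
    integrable_of_continuous ((hs k).continuous.mul (smoothOnS2_coord k).continuous)
  have hsq : ∑ k, ⨍ y, y.1 k * g y * X k y ∂area = ⨍ y, g y ∂area := by
    simp only [average_eq, smul_eq_mul, ← Finset.mul_sum]
    rw [← integral_finsetSum _ fun k _ => hint k]
    simp only [X, mul_right_comm _ (g _), ← Finset.sum_mul, S2.sum_coord_mul_self, one_mul]
  calc 3 * ∫ x, 2 * δ x * g x ∂area
      = ∑ k, ∫ x, 2 * translationKernel k (fun y => y.1 k * g y) x * δ x ∂area := by
        rw [← integral_finsetSum _ fun k _ => hker k, ← integral_const_mul]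
        refine integral_congr_ae (ae_of_all _ fun x => ?_)
        simp only [← Finset.sum_mul, ← Finset.mul_sum, sum_translationKernel_coord_mul hg.c1]
        ring
    _ = _ := by
        simp only [integral_translationKernel_mul_of_orthogonal hδ horth (hs _),
          Finset.sum_add_distrib, ← Finset.sum_mul, ← Finset.mul_sum, hsq]

theorem integral_mul_coord_of_orthogonal (k : Fin 3) : ∫ x, 2 * δ x * X k x ∂area = 0 := by
  have h := three_mul_integral_mul_of_orthogonal hδ horth (smoothOnS2_coord k)
  have : NeZero area := ⟨Measure.toSphere_ne_zero _⟩
  have hA : area.real Set.univ ≠ 0 := measureReal_univ_ne_zero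
  simp only [average_eq, smul_eq_mul, integral_coord_mul_coord, integral_coord, mul_ite, mul_zero,
    zero_mul, ite_mul, Finset.sum_ite_eq', Finset.mem_univ, if_true, add_zero,
    inv_mul_cancel_left₀ hA, div_eq_mul_inv] at h
  simp only [X] at h ⊢
  linarith

theorem eq_average_of_orthogonal (x : S2) : δ x = ⨍ y, δ y ∂area := by
  have hδ' : Continuous fun x => δ x - ⨍ y, δ y ∂area := hδ.sub continuous_const
  have hae : ∀ᵐ x ∂area, δ x - ⨍ y, δ y ∂area = 0 := by
    refine ae_eq_zero_of_integral_contMDiff_smul_eq_zero (𝓡 2)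
      (integrable_of_continuous hδ').locallyIntegrable fun g (hg : SmoothOnS2 g) _ => ?_
    have h := three_mul_integral_mul_of_orthogonal hδ horth hg
    simp only [integral_mul_coord_of_orthogonal hδ horth, mul_zero, Finset.sum_const_zero,
      zero_add] at h
    have hgδ : Integrable (fun x => g x * δ x) area :=
      integrable_of_continuous (hg.continuous.mul hδ)
    simp only [smul_eq_mul, mul_sub]
    rw [integral_sub hgδ ((integrable_of_continuous hg.continuous).mul_const _),
      integral_mul_const]
    simp only [average_eq, smul_eq_mul, mul_assoc, integral_const_mul, mul_comm (g _)] at h ⊢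
    linear_combination h / 6
  exact sub_eq_zero.1 <| congrFun
    ((Continuous.ae_eq_iff_eq area hδ' (continuous_const (y := (0 : ℝ)))).1 hae) x

end Orthogonality

theorem integral_translationKernel_mul_eq_zero_iff {δ : S2 → ℝ} (hδ : Continuous δ) :
    (∀ h, SmoothOnS2 h → SupportedInHigherModes h →
        ∀ k, ∫ x, 2 * translationKernel k h x * δ x ∂area = 0)
      ↔ ∃ c : ℝ, ∀ x, δ x = c := by
  refine ⟨fun horth => ⟨_, eq_average_of_orthogonal hδ horth⟩, ?_⟩
  rintro ⟨c, hc⟩ h hs hh k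
  simp only [hc, integral_mul_const, integral_const_mul, integral_translationKernel hs.c1,
    mul_comm (X k _), hh.2, mul_zero, zero_mul]

theorem HasTotalFlux.unique {Q : ℝ → ℝ} {F F' : ℝ} (h : HasTotalFlux Q F)
    (h' : HasTotalFlux Q F') : F = F' := by
  obtain ⟨a, b, ha, hb, rfl⟩ := h
  obtain ⟨a', b', ha', hb', rfl⟩ := h'
  rw [tendsto_nhds_unique ha ha', tendsto_nhds_unique hb hb']

namespace Data

variable {D : Data} (Lp : ScriLimit D atTop) (Lm : ScriLimit D atBot)

theorem hasTotalFlux_energy :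
    HasTotalFlux D.energy (∫ x, 2 * (Lp.mass x - Lm.mass x) ∂area) := by
  simp only [mul_sub]
  exact hasTotalFlux_integral
    (Lp.boundedLimit_mass.const_mul 2) (Lm.boundedLimit_mass.const_mul 2)

theorem hasTotalFlux_momentum (k : Fin 3) :
    HasTotalFlux (D.momentum k) (∫ x, 2 * (Lp.mass x - Lm.mass x) * X k x ∂area) := by
  have hX : Continuous (X k) := (smoothOnS2_coord k).continuous
  simp only [mul_sub, sub_mul]
  exact hasTotalFlux_integral
    ((Lp.boundedLimit_mass.const_mul 2).mul (.of_continuous hX))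
    ((Lm.boundedLimit_mass.const_mul 2).mul (.of_continuous hX))

theorem centerOfMassFluxInvariant_iff (hD : D.IsVacuum) :
    D.CenterOfMassFluxInvariant ↔ ∃ c : ℝ, ∀ x, Lp.mass x - Lm.mass x = c := by
  have hδ : Continuous fun x => Lp.mass x - Lm.mass x :=
    Lp.boundedLimit_mass.continuous_limit.sub Lm.boundedLimit_mass.continuous_limit
  have hF := hasTotalFlux_centerOfMass hD Lp Lm
  rw [← integral_translationKernel_mul_eq_zero_iff hδ]
  constructor
  · rintro ⟨F, P, E, hF', -, -, hinv⟩ h hs hh k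
    have hlow : (fun x => 0 + ∑ i, (0 : Fin 3 → ℝ) i * X i x + h x) = h := by
      simp only [Pi.zero_apply, zero_mul, Finset.sum_const_zero, zero_add]
    have hh' := isSupertranslate_supertranslate hD hs
    have hflux := (hinv 0 0 h hs hh _ (hlow.symm ▸ hh') k).unique
      (hh'.hasTotalFlux_centerOfMass hD Lp Lm hs k)
    rw [(hF' k).unique (hF k)] at hflux
    simpa using hflux
  · intro horth
    refine ⟨_, _, _, hF, hasTotalFlux_momentum Lp Lm, hasTotalFlux_energy Lp Lm, ?_⟩
    intro a b h hs hh D' hD' k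
    have hflux := hD'.hasTotalFlux_centerOfMass hD Lp Lm ((smoothOnS2_lowModes a b).add hs) k
    have hker := integral_translationKernel_lowModes_add_mul hs hδ a b k
    rw [horth h hs hh k, add_zero] at hker
    rw [add_assoc, ← hker]
    exact hflux

end Data

end NullInfinity

end

theorem mainTheorem4 (D : NullInfinity.Data) (hD : D.IsVacuum) (hN : D.NewsDecay) :
    ∃ mPlus mMinus : NullInfinity.S2 → ℝ,
      (∀ x, Tendsto (fun u => D.m u x) atTop (𝓝 (mPlus x))) ∧
      (∀ x, Tendsto (fun u => D.m u x) atBot (𝓝 (mMinus x))) ∧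
      (D.CenterOfMassFluxInvariant ↔ ∃ c : ℝ, ∀ x, mPlus x - mMinus x = c) ∧
      ∃ F : Fin 3 → ℝ, (∀ k, NullInfinity.HasTotalFlux (D.centerOfMass k) (F k)) ∧
        ∀ f : NullInfinity.S2 → ℝ, NullInfinity.SmoothOnS2 f →
          ∀ D' : NullInfinity.Data, D.IsSupertranslate f D' →
            ∀ k, ∃ F' : ℝ, NullInfinity.HasTotalFlux (D'.centerOfMass k) F' ∧
              F' - F k = ∫ x, (2 * NullInfinity.X k x * f x
                  + 2 * ∑ i, NullInfinity.grad (NullInfinity.X k) x i * NullInfinity.grad f x i)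
                  * (mPlus x - mMinus x) ∂NullInfinity.area ∧
              (ContMDiff (𝓡 2) 𝓘(ℝ, ℝ) 1 (fun x => mPlus x - mMinus x) →
                F' - F k = ∫ x, (6 * NullInfinity.X k x * (mPlus x - mMinus x)
                  - 2 * ∑ i, NullInfinity.grad (NullInfinity.X k) x i
                      * NullInfinity.grad (fun y => mPlus y - mMinus y) x i)
                  * f x ∂NullInfinity.area) := by
  obtain ⟨Lp⟩ := NullInfinity.Data.exists_scriLimit hD hN (Or.inl rfl)
  obtain ⟨Lm⟩ := NullInfinity.Data.exists_scriLimit hD hN (Or.inr rfl)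
  refine ⟨Lp.mass, Lm.mass, Lp.boundedLimit_mass.tendsto, Lm.boundedLimit_mass.tendsto,
    NullInfinity.Data.centerOfMassFluxInvariant_iff Lp Lm hD, _,
    NullInfinity.Data.hasTotalFlux_centerOfMass hD Lp Lm,
    fun f hf D' hD' k => ⟨_, hD'.hasTotalFlux_centerOfMass hD Lp Lm hf k, ?_, fun hδ => ?_⟩⟩
  · simp only [NullInfinity.two_mul_translationKernel hf.c1, add_sub_cancel_left]
  · rw [add_sub_cancel_left, NullInfinity.integral_translationKernel_mul hf.c1 hδ]
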